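/- Let $B$ be a connected topological space with a universal covering $p\colon\tilde B\to B$, that is, a covering map with $\tilde B$ simply connected whose deck transformations act transitively on the fibres (the last condition is automatic if $B$ is locally path connected). Let $\mathcal M$ be a local system on $B$, i.e. a locally constant sheaf of abelian groups. Let $b_0\in B$ and $\tilde b_0\in p^{-1}(b_0)$, let $G=\pi_1(B,b_0)$, and let $M=\mathcal M_{b_0}$ be the fibre (stalk) of $\mathcal M$ at $b_0$, regarded as a $\mathbb ZG$-module through monodromy. The group $G$ acts on $\tilde B$ by deck transformations (the identification of $G$ with deck transformations being given by $\tilde b_0$), so that the singular chain complex $S_\bullet(\tilde B,\mathbb Z)$ is a complex of $\mathbb ZG$-modules and its homology groups $H_q(\tilde B,\mathbb Z)$ are $\mathbb ZG$-modules. The cohomology of $\mathcal M$ is defined by $$H^n(B,\mathcal M)=H^n\bigl(\operatorname{Hom}_{\mathbb ZG}(S_\bullet(\tilde B,\mathbb Z),M)\bigr).$$ Then there is a convergent first quadrant cohomological spectral sequence of abelian groups $$E_2^{p,q}=\operatorname{Ext}^p_{\mathbb ZG}\bigl(H_q(\tilde B,\mathbb Z),M\bigr)\Longrightarrow H^{p+q}(B,\mathcal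 M);$$ here convergence means that each $H^n(B,\mathcal M)$ has a decreasing filtration $H^n=F^0\supseteq F^1\supseteq\dots\supseteq F^{n+1}=0$ with $F^p/F^{p+1}\cong E_\infty^{p,n-p}$ for $0\le p\le n$. Moreover $H^1(B,\mathcal M)\cong H^1(G,M)$, where $H^1(G,M)=\operatorname{Ext}^1_{\mathbb ZG}(\mathbb Z,M)$ is group cohomology. -/

import Mathlib

open CategoryTheory TopologicalSpace Opposite Topology

universe u

/-! ### Universal coverings and deck transformations -/

/-- A universal covering: a covering map whose total space is simply connected (so path connected
and nonempty) and whose deck transformations act transitively on the fibres. The last condition is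
automatic when the base is locally path connected, see `IsUniversalCovering.of_isCoveringMap`. -/
structure IsUniversalCovering {E B : Type*} [TopologicalSpace E] [TopologicalSpace B]
    (p : E → B) : Prop where
  isCoveringMap : IsCoveringMap p
  simplyConnectedSpace : SimplyConnectedSpace E
  exists_deck : ∀ e e' : E, p e = p e' → ∃ φ : E ≃ₜ E, p ∘ φ = p ∧ φ e = e'

namespace IsUniversalCovering

section

variable {E B : Type*} [TopologicalSpace E] [TopologicalSpace B] {p : E → B}

/-- A simply connected covering of a locally path connected space is a universal covering. -/
theorem of_isCoveringMap [LocallyPathConnectedSpace B] [SimplyConnectedSpace E]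
    (hp : IsCoveringMap p) : IsUniversalCovering p := by
  have : LocallyPathConnectedSpace E := by
    refine ⟨fun e ↦ ⟨fun U ↦ ⟨fun hU ↦ ?_, fun ⟨V, hV, hVU⟩ ↦ Filter.mem_of_superset hV.1 hVU⟩⟩⟩
    obtain ⟨f, hf, rfl⟩ := hp.isLocalHomeomorph e
    have h1 : f.symm ⁻¹' U ∩ f.target ∈ 𝓝 (f e) := by
      refine Filter.inter_mem ?_ (f.open_target.mem_nhds (f.map_source hf))
      exact (f.continuousAt_symm (f.map_source hf)) (by rwa [f.left_inv hf])
    obtain ⟨W, ⟨hW, hWc⟩, hWU⟩ := (path_connected_basis (f e)).mem_iff.mp h1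
    refine ⟨f.symm '' W, ⟨?_, hWc.image' (f.continuousOn_symm.mono fun w hw ↦ (hWU hw).2)⟩, ?_⟩
    · have := f.symm.image_mem_nhds (f.map_source hf) hW
      rwa [f.left_inv hf] at this
    · rintro _ ⟨w, hw, rfl⟩
      exact (hWU hw).1
  refine ⟨hp, inferInstance, fun e e' h ↦ ?_⟩
  have key : ∀ a a' : E, p a = p a' → ∃ F : C(E, E), F a = a' ∧ p ∘ F = p := fun a a' haa' ↦
    (hp.existsUnique_continuousMap_lifts ⟨p, hp.continuous⟩ a a' haa'.symm).exists
  obtain ⟨F, hF, hpF⟩ := key e e' h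
  obtain ⟨F', hF', hpF'⟩ := key e' e h.symm
  have inv : ∀ (f g : C(E, E)) (a : E), p ∘ f = p → p ∘ g = p → g (f a) = a →
      Function.LeftInverse g f := fun f g a hf hg hgf ↦ by
    refine congrFun (hp.eq_of_comp_eq (g₁ := g ∘ f) (g₂ := id) (g.continuous.comp f.continuous)
      continuous_id ?_ a hgf)
    rw [← Function.comp_assoc, hg, hf]
    rfl
  exact ⟨⟨⟨F, F', inv F F' e hpF hpF' (by rw [hF, hF']), inv F' F e' hpF' hpF (by rw [hF', hF])⟩,
    F.continuous, F'.continuous⟩, hpF, hF⟩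

/-- Two deck transformations that agree at a point are equal. -/
theorem deck_ext (hp : IsUniversalCovering p) {φ ψ : E ≃ₜ E} (hφ : p ∘ φ = p) (hψ : p ∘ ψ = p)
    (e : E) (h : φ e = ψ e) : φ = ψ := by
  have := hp.simplyConnectedSpace
  exact DFunLike.coe_injective
    (hp.isCoveringMap.eq_of_comp_eq φ.continuous ψ.continuous (hφ.trans hψ.symm) e h)

/-- Deck transformations commute with the lifting of paths. -/
theorem _root_.IsCoveringMap.deck_monodromy (hp : IsCoveringMap p) {φ : E ≃ₜ E}
    (hφ : p ∘ φ = p) {x y : B} (γ : Path.Homotopic.Quotient x y) (e e' : p ⁻¹' {x})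
    (h : φ e = e') : φ (hp.monodromy γ e) = hp.monodromy γ e' := by
  obtain ⟨γ⟩ := γ
  have hφ' : ∀ z, p (φ z) = p z := fun z ↦ congrFun hφ z
  have he : (γ : C(unitInterval, B)) 0 = p e := γ.source.trans e.2.symm
  have he' : (γ : C(unitInterval, B)) 0 = p e' := γ.source.trans e'.2.symm
  have key : (⟨φ, φ.continuous⟩ : C(E, E)).comp (hp.liftPath γ e he) = hp.liftPath γ e' he' := by
    rw [hp.eq_liftPath_iff']
    refine ⟨?_, ?_⟩
    · ext t
      have := congrFun (hp.liftPath_lifts γ e he) t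
      simpa [hφ'] using this
    · simp [hp.liftPath_zero, h]
  exact DFunLike.congr_fun key 1

variable (hp : IsUniversalCovering p) {b₀ : B} (e₀ : p ⁻¹' {b₀})

theorem exists_deck_monodromy (g : FundamentalGroup B b₀) :
    ∃ φ : E ≃ₜ E, p ∘ φ = p ∧ φ e₀ = hp.isCoveringMap.monodromyPerm b₀ g⁻¹ e₀ :=
  hp.exists_deck _ _ (e₀.2.trans (hp.isCoveringMap.monodromyPerm b₀ g⁻¹ e₀).2.symm)

/-- The action of `π₁(B, b₀)` on the universal covering by deck transformations. In Mathlib, `g * h`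
means first `h`, then `g`, so that `π₁(B, b₀)` acts on fibres from the left by lifting paths; this
commutes with deck transformations. So it is the deck transformation taking `e₀` to the endpoint of
the lift at `e₀` of the *inverse* of `g` that is multiplicative in `g`. -/
noncomputable def deck : FundamentalGroup B b₀ →* (E ≃ₜ E) where
  toFun g := (hp.exists_deck_monodromy e₀ g).choose
  map_one' := by
    obtain ⟨h1, h2⟩ := (hp.exists_deck_monodromy e₀ 1).choose_spec
    refine hp.deck_ext h1 rfl e₀ (h2.trans ?_)
    rw [inv_one, map_one]
    rfl
  map_mul' g h := by
    obtain ⟨h1, h2⟩ := (hp.exists_deck_monodromy e₀ (g * h)).choose_spec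
    obtain ⟨g1, g2⟩ := (hp.exists_deck_monodromy e₀ g).choose_spec
    obtain ⟨k1, k2⟩ := (hp.exists_deck_monodromy e₀ h).choose_spec
    refine hp.deck_ext h1 ?_ e₀ (h2.trans ?_)
    · funext z
      exact (congrFun g1 _).trans (congrFun k1 z)
    · rw [Homeomorph.mul_apply, k2]
      rw [mul_inv_rev, map_mul]
      exact (hp.isCoveringMap.deck_monodromy g1 (h⁻¹ : FundamentalGroup B b₀) e₀
        (hp.isCoveringMap.monodromyPerm b₀ g⁻¹ e₀) g2).symm

theorem comp_deck (g : FundamentalGroup B b₀) : p ∘ hp.deck e₀ g = p :=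
  (hp.exists_deck_monodromy e₀ g).choose_spec.1

theorem deck_apply (g : FundamentalGroup B b₀) :
    hp.deck e₀ g e₀ = hp.isCoveringMap.monodromyPerm b₀ g⁻¹ e₀ :=
  (hp.exists_deck_monodromy e₀ g).choose_spec.2

end

end IsUniversalCovering

/-! ### Singular chains of the universal covering as a complex of `ℤ[π₁]`-modules -/

namespace IsUniversalCovering

variable {B E : TopCat.{u}} {p : E → B} (hp : IsUniversalCovering p) {b₀ : B} (e₀ : p ⁻¹' {b₀})

/-- The universal covering as a space with an action of `π₁(B, b₀)`. -/
noncomputable def deckAction : Action TopCat.{u} (FundamentalGroup B b₀) where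
  V := E
  ρ :=
    { toFun g := TopCat.ofHom ⟨hp.deck e₀ g, (hp.deck e₀ g).continuous⟩
      map_one' := by
        rw [map_one]
        rfl
      map_mul' g h := by
        rw [map_mul]
        rfl }

/-- The singular simplicial set of the universal covering, with the action of `π₁(B, b₀)`. -/
noncomputable def singularSimplices :
    SimplicialObject (Action (Type u) (FundamentalGroup B b₀)) where
  obj n := ((TopCat.toSSet ⋙ (evaluation _ _).obj n).mapAction _).obj (hp.deckAction e₀)
  map f :=
    { hom := (TopCat.toSSet.obj E).map f
      comm g := ((TopCat.toSSet.map ((hp.deckAction e₀).ρ g)).naturality f).symm }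
  map_id n := by
    apply Action.Hom.ext
    exact (TopCat.toSSet.obj E).map_id n
  map_comp f g := by
    apply Action.Hom.ext
    exact (TopCat.toSSet.obj E).map_comp f g

/-- The singular chain complex `S_•(E, ℤ)` of the universal covering, as a complex of modules over
the group ring of `π₁(B, b₀)`: `S_n` is the free abelian group on the singular `n`-simplices of `E`,
on which the group acts by deck transformations, and the boundary is the alternating sum of the
faces. -/
noncomputable def singularChains :
    ChainComplex (ModuleCat.{u} (MonoidAlgebra ℤ (FundamentalGroup B b₀))) ℕ :=
  (AlgebraicTopology.alternatingFaceMapComplex _).obj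
    (((SimplicialObject.whiskering _ _).obj
      (Rep.linearization ℤ (FundamentalGroup B b₀) ⋙ Rep.toModuleMonoidAlgebra)).obj
        (hp.singularSimplices e₀))

/-- The singular homology `H_q(E, ℤ)`, as a module over the group ring of `π₁(B, b₀)`. -/
noncomputable def homology (q : ℕ) :
    ModuleCat.{u} (MonoidAlgebra ℤ (FundamentalGroup B b₀)) :=
  (hp.singularChains e₀).homology q

end IsUniversalCovering

/-! ### Local systems and their monodromy -/

/-- A local system on `B`: a sheaf `F` of abelian groups that is locally constant, that is, every
point has an open neighbourhood `U` with an abelian group `A` and a homomorphism `A → F(U)`, in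
other words a morphism from the constant presheaf `A` to `F` restricted to `U`, inducing
isomorphisms from `A` to all stalks `F_y`, `y ∈ U`. -/
structure LocalSystem (B : TopCat.{u}) where
  /-- the underlying sheaf -/
  sheaf : TopCat.Sheaf AddCommGrpCat.{u} B
  isLocallyConstant : ∀ x : B, ∃ U : Opens B, x ∈ U ∧
    ∃ (A : AddCommGrpCat.{u}) (f : A ⟶ sheaf.presheaf.obj (op U)),
      ∀ (y : B) (hy : y ∈ U), Function.Bijective fun a : A ↦ sheaf.presheaf.germ U y hy (f a)

namespace LocalSystem

variable {B : TopCat.{u}} (F : LocalSystem B)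

/-- The étalé space of a local system: pairs of a point of `B` and an element of the stalk. -/
abbrev EtaleSpace := F.sheaf.presheaf.EtaleSpace

/-- The projection of the étalé space to `B`. -/
abbrev proj : F.EtaleSpace → B := TopCat.Presheaf.EtaleSpace.base

variable {F} in
theorem continuousAt_etaleSpace {X : Type*} [TopologicalSpace X] {b : X → B}
    {s : ∀ x, F.sheaf.presheaf.stalk (b x)} {x : X} (hb : ContinuousAt b x)
    {U : Opens B} (hU : b x ∈ U) (f : F.sheaf.presheaf.obj (op U))
    (h : ∀ᶠ y in 𝓝 x, ∃ hy : b y ∈ U, s y = F.sheaf.presheaf.germ U _ hy f) :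
    ContinuousAt (fun y ↦ (⟨b y, s y⟩ : F.EtaleSpace)) x := by
  obtain ⟨_, hx⟩ := h.self_of_nhds
  simp only [ContinuousAt, TopologicalSpace.nhds_generateFrom, Filter.tendsto_iInf,
    Set.mem_ofPred_eq, Filter.tendsto_principal]
  rintro _ ⟨hmem, V, f', rfl⟩
  obtain ⟨hV, hg⟩ := hmem
  obtain ⟨W, hW, iU, iV, hUV⟩ := F.sheaf.presheaf.germ_eq (b x) hU hV f f' (hx.symm.trans hg)
  filter_upwards [h, hb (W.isOpen.mem_nhds hW)] with y ⟨hy, hys⟩ hyW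
  refine ⟨iV.le hyW, ?_⟩
  rw [hys, ← F.sheaf.presheaf.germ_res_apply iU (b y) hyW, hUV, F.sheaf.presheaf.germ_res_apply]

/-- A local trivialization of the étalé space. -/
noncomputable def trivialization {U : Opens B} {A : AddCommGrpCat.{u}}
    (f : A ⟶ F.sheaf.presheaf.obj (op U))
    (hf : ∀ (y : B) (hy : y ∈ U),
      Function.Bijective fun a : A ↦ F.sheaf.presheaf.germ U y hy (f a)) :
    (F.proj ⁻¹' U) ≃ₜ U × WithDiscreteTopology A where
  toFun s := (⟨s.1.base, s.2⟩,
    .toTopology ⊥ (Function.surjInv (hf s.1.base s.2).surjective s.1.germ))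
  invFun z := ⟨⟨z.1, F.sheaf.presheaf.germ U z.1 z.1.2 (f z.2.ofTopology)⟩, z.1.2⟩
  left_inv := by
    rintro ⟨⟨y, s⟩, hs⟩
    refine Subtype.ext ?_
    change TopCat.Presheaf.EtaleSpace.mk y _ = TopCat.Presheaf.EtaleSpace.mk y _
    congr 1
    exact Function.surjInv_eq (hf y hs).surjective s
  right_inv := by
    rintro ⟨⟨y, hy⟩, ⟨a⟩⟩
    refine Prod.ext rfl ?_
    exact congrArg (WithTopology.toTopology ⊥) (Function.leftInverse_surjInv (hf y hy) a)
  continuous_toFun := by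
    refine .prodMk (by fun_prop) ?_
    simp_rw [continuous_iff_continuousAt, ContinuousAt, nhds_discrete, Filter.tendsto_pure,
      nhds_subtype, Filter.eventually_comap]
    rintro ⟨g, hg⟩
    filter_upwards [g.eventually_nhds hg _ (Function.surjInv_eq (hf g.base hg).surjective g.germ)]
    rintro _ ⟨hgU, hgf⟩ g' rfl
    refine congrArg _ ?_
    rw [hgf]
    exact Function.leftInverse_surjInv (hf _ hgU) _
  continuous_invFun := by
    refine Continuous.subtype_mk ?_ _
    rw [continuous_iff_continuousAt]
    rintro ⟨y, ⟨a⟩⟩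
    rw [continuousAt_prod_of_discrete_right]
    exact continuousAt_etaleSpace continuous_subtype_val.continuousAt y.2 (f a)
      (Filter.Eventually.of_forall fun z ↦ ⟨z.2, rfl⟩)

theorem isCoveringMap_proj : IsCoveringMap F.proj := by
  intro x
  obtain ⟨U, hxU, A, f, hf⟩ := F.isLocallyConstant x
  exact .to_isEvenlyCovered_preimage (I := WithDiscreteTopology A) ⟨inferInstance, U, hxU, U.isOpen,
    U.isOpen.preimage (TopCat.Presheaf.EtaleSpace.continuous_base _), F.trivialization f hf,
    fun _ ↦ rfl⟩

/-- The fibre of the étalé space over `b` is the stalk at `b`. -/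
noncomputable def fibreEquiv (b : B) : F.proj ⁻¹' {b} ≃ F.sheaf.presheaf.stalk b where
  toFun e := cast (congrArg (fun x : B ↦ (F.sheaf.presheaf.stalk x : Type u)) e.2) e.1.germ
  invFun m := ⟨⟨b, m⟩, rfl⟩
  left_inv := by
    rintro ⟨⟨_, _⟩, rfl⟩
    rfl
  right_inv _ := rfl

theorem fibreEquiv_eq {b : B} {e : F.proj ⁻¹' {b}} {m : F.sheaf.presheaf.stalk b}
    (h : e.1 = ⟨b, m⟩) : F.fibreEquiv b e = m := by
  rw [← (F.fibreEquiv b).eq_symm_apply]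
  exact Subtype.ext h

theorem eq_mk_fibreEquiv {b : B} (e : F.proj ⁻¹' {b}) : e.1 = ⟨b, F.fibreEquiv b e⟩ :=
  congrArg Subtype.val ((F.fibreEquiv b).symm_apply_apply e).symm

theorem mk_add_mk {b c : B} {x x' : F.sheaf.presheaf.stalk b} {y y' : F.sheaf.presheaf.stalk c}
    (h : (⟨b, x⟩ : F.EtaleSpace) = ⟨c, y⟩) (h' : (⟨b, x'⟩ : F.EtaleSpace) = ⟨c, y'⟩) :
    (⟨b, x + x'⟩ : F.EtaleSpace) = ⟨c, y + y'⟩ := by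
  cases h
  cases h'
  rfl

/-- The action of a loop on the stalk, by lifting the loop to the étalé space, is additive. -/
theorem monodromy_add (b : B) (g : FundamentalGroup B b) (m m' : F.sheaf.presheaf.stalk b) :
    F.fibreEquiv b (F.isCoveringMap_proj.monodromyPerm b g ((F.fibreEquiv b).symm (m + m'))) =
      F.fibreEquiv b (F.isCoveringMap_proj.monodromyPerm b g ((F.fibreEquiv b).symm m)) +
      F.fibreEquiv b (F.isCoveringMap_proj.monodromyPerm b g ((F.fibreEquiv b).symm m')) := by
  obtain ⟨γ⟩ := g
  have lift : ∀ m : F.sheaf.presheaf.stalk b, ∃ (L : C(unitInterval, F.EtaleSpace))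
      (s : ∀ t, F.sheaf.presheaf.stalk (γ t)), (∀ t, L t = ⟨γ t, s t⟩) ∧ L 0 = ⟨b, m⟩ := by
    intro m
    have h0 : (γ : C(unitInterval, B)) 0 = F.proj ⟨b, m⟩ := γ.source
    let L := F.isCoveringMap_proj.liftPath γ ⟨b, m⟩ h0
    have hL : ∀ t, ∃ s, L t = ⟨γ t, s⟩ := fun t ↦ by
      have : (L t).base = γ t := congrFun (F.isCoveringMap_proj.liftPath_lifts γ ⟨b, m⟩ h0) t
      rw [← this]
      exact ⟨_, rfl⟩
    choose s hs using hL
    exact ⟨L, s, hs, F.isCoveringMap_proj.liftPath_zero _ _ _⟩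
  -- a lift computes the monodromy
  have val : ∀ (m : F.sheaf.presheaf.stalk b) (L : C(unitInterval, F.EtaleSpace))
      (s : ∀ t, F.sheaf.presheaf.stalk (γ t)), (∀ t, L t = ⟨γ t, s t⟩) → L 0 = ⟨b, m⟩ →
      (F.isCoveringMap_proj.monodromyPerm b (Path.Homotopic.Quotient.mk γ)
        ((F.fibreEquiv b).symm m)).1 = ⟨γ 1, s 1⟩ := by
    intro m L s hs h0
    have h0' : (γ : C(unitInterval, B)) 0 = F.proj ⟨b, m⟩ := γ.source
    have : L = F.isCoveringMap_proj.liftPath γ ⟨b, m⟩ h0' := by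
      rw [IsCoveringMap.eq_liftPath_iff']
      refine ⟨?_, h0⟩
      funext t
      exact congrArg _ (hs t)
    rw [← hs 1, this]
    rfl
  obtain ⟨L, s, hs, h0⟩ := lift m
  obtain ⟨L', s', hs', h0'⟩ := lift m'
  have hcont : Continuous fun t ↦ (⟨γ t, s t + s' t⟩ : F.EtaleSpace) := by
    rw [continuous_iff_continuousAt]
    intro t
    have hc : Continuous fun t ↦ (⟨γ t, s t⟩ : F.EtaleSpace) := by
      simpa only [← hs] using L.continuous
    have hc' : Continuous fun t ↦ (⟨γ t, s' t⟩ : F.EtaleSpace) := by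
      simpa only [← hs'] using L'.continuous
    obtain ⟨U, hU, f, hf⟩ := TopCat.Presheaf.EtaleSpace.exists_section_of_tendsto (hc.tendsto t)
    obtain ⟨U', hU', f', hf'⟩ := TopCat.Presheaf.EtaleSpace.exists_section_of_tendsto (hc'.tendsto t)
    refine continuousAt_etaleSpace γ.continuous.continuousAt (U := U ⊓ U') ⟨hU, hU'⟩
      (F.sheaf.presheaf.map (homOfLE inf_le_left).op f +
        F.sheaf.presheaf.map (homOfLE inf_le_right).op f') ?_
    filter_upwards [hf, hf'] with r ⟨hr, h⟩ ⟨hr', h'⟩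
    have hr2 : γ r ∈ U ⊓ U' := ⟨hr, hr'⟩
    refine ⟨hr2, ?_⟩
    refine (congrArg₂ (· + ·) (h.trans ?_) (h'.trans ?_)).trans (map_add _ _ _).symm
    · exact (F.sheaf.presheaf.germ_res_apply (homOfLE inf_le_left) (γ r) hr2 f).symm
    · exact (F.sheaf.presheaf.germ_res_apply (homOfLE inf_le_right) (γ r) hr2 f').symm
  have hsum := val (m + m') ⟨_, hcont⟩ (fun t ↦ s t + s' t) (fun _ ↦ rfl)
    (F.mk_add_mk ((hs 0).symm.trans h0) ((hs' 0).symm.trans h0'))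
  refine F.fibreEquiv_eq (hsum.trans (F.mk_add_mk ?_ ?_))
  · rw [← val m L s hs h0]
    exact F.eq_mk_fibreEquiv _
  · rw [← val m' L' s' hs' h0']
    exact F.eq_mk_fibreEquiv _

/-- The action of a loop on the stalk at its base point, by lifting the loop to the étalé space. -/
noncomputable def transport (b : B) (g : FundamentalGroup B b) :
    F.sheaf.presheaf.stalk b →+ F.sheaf.presheaf.stalk b :=
  AddMonoidHom.mk' (fun m ↦ F.fibreEquiv b
    (F.isCoveringMap_proj.monodromyPerm b g ((F.fibreEquiv b).symm m))) (F.monodromy_add b g)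

theorem transport_one (b : B) (m : F.sheaf.presheaf.stalk b) : F.transport b 1 m = m := by
  refine (congrArg (F.fibreEquiv b) (?_ : _ = (F.fibreEquiv b).symm m)).trans
    ((F.fibreEquiv b).apply_symm_apply m)
  rw [map_one]
  rfl

theorem transport_mul (b : B) (g h : FundamentalGroup B b) (m : F.sheaf.presheaf.stalk b) :
    F.transport b (g * h) m = F.transport b g (F.transport b h m) := by
  refine congrArg (F.fibreEquiv b) ?_
  rw [map_mul]
  exact congrArg (F.isCoveringMap_proj.monodromyPerm b g)
    ((F.fibreEquiv b).symm_apply_apply _).symm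

/-- The fibre of a local system at `b` (its stalk) as a representation of `π₁(B, b)`: a loop acts by
lifting it to the étalé space. -/
noncomputable def monodromy (b : B) :
    Representation ℤ (FundamentalGroup B b) (F.sheaf.presheaf.stalk b) where
  toFun g := (F.transport b g).toIntLinearMap
  map_one' := LinearMap.ext fun m ↦ F.transport_one b m
  map_mul' g h := LinearMap.ext fun m ↦ F.transport_mul b g h m

/-- The fibre of a local system at `b` as a module over the group ring of `π₁(B, b)`. -/
noncomputable def fibre (b : B) : ModuleCat.{u} (MonoidAlgebra ℤ (FundamentalGroup B b)) :=
  Rep.toModuleMonoidAlgebra.obj (Rep.of (F.monodromy b))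

end LocalSystem

/-! ### Cohomology -/

/-- The cochain complex `Hom(K, M)` with differential given by precomposition. -/
def homComplex {C : Type*} [Category.{u} C] [Preadditive C] (K : ChainComplex C ℕ) (M : C) :
    CochainComplex AddCommGrpCat.{u} ℕ where
  X n := AddCommGrpCat.of (K.X n ⟶ M)
  d i j := AddCommGrpCat.ofHom (Preadditive.leftComp M (K.d j i))
  shape i j h := by
    ext f
    change K.d j i ≫ f = 0
    rw [K.shape j i h, Limits.zero_comp]
  d_comp_d' i j k _ _ := by
    ext f
    change K.d k j ≫ K.d j i ≫ f = 0
    rw [← Category.assoc, K.d_comp_d, Limits.zero_comp]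

/-- The cohomology `H^n(B, F)` of a local system `F` on a space `B` with a universal covering
`p : E → B`: the cohomology of the complex `Hom_{ℤ[G]}(S_•(E, ℤ), M)`, where `G = π₁(B, b₀)` and `M`
is the fibre of `F` at `b₀`. -/
noncomputable def LocalSystem.cohomology {B E : TopCat.{u}} (F : LocalSystem B) {p : E → B}
    (hp : IsUniversalCovering p) {b₀ : B} (e₀ : p ⁻¹' {b₀}) (n : ℕ) : AddCommGrpCat.{u} :=
  (homComplex (hp.singularChains e₀) (F.fibre b₀)).homology n

/-- `Ext^n_R(A, M)` as an abelian group. -/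
noncomputable def extGroup {R : Type u} [Ring R] (A M : ModuleCat.{u} R) (n : ℕ) :
    AddCommGrpCat.{u} :=
  AddCommGrpCat.of (Abelian.Ext.{u} A M n)

/-- The group cohomology `H^n(G, M) = Ext^n_{ℤ[G]}(ℤ, M)` of a `ℤ[G]`-module `M`, where `G` acts
trivially on `ℤ`. -/
noncomputable def groupCohomologyExt {G : Type u} [Group G] (M : ModuleCat.{u} (MonoidAlgebra ℤ G))
    (n : ℕ) : AddCommGrpCat.{u} :=
  extGroup (Rep.toModuleMonoidAlgebra.obj (Rep.trivial ℤ G (ULift.{u} ℤ))) M n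

/-! ### Convergence of first quadrant spectral sequences -/

/-- A first quadrant cohomological spectral sequence converges to `H`: each `H n` has a decreasing
filtration `H n = F⁰ ⊇ F¹ ⊇ ⋯ ⊇ Fⁿ⁺¹ = 0` with `Fᵖ / Fᵖ⁺¹ ≅ E_∞^{p,q}` for `p + q = n`. Here
`E_∞^{p,q}` is `E_r^{p,q}` for any `r > max(p, q + 1)`, since all differentials to and from the spot
`(p, q)` vanish on these pages. -/
def ConvergesTo (E : E₂CohomologicalSpectralSequenceNat AddCommGrpCat.{u})
    (H : ℕ → AddCommGrpCat.{u}) : Prop :=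
  ∀ n : ℕ, ∃ Fil : ℕ → AddSubgroup (H n), Antitone Fil ∧ Fil 0 = ⊤ ∧ Fil (n + 1) = ⊥ ∧
    ∀ p q : ℕ, p + q = n → ∀ (r : ℤ) (hr : 2 ≤ r), (p : ℤ) < r → (q + 1 : ℤ) < r →
      Nonempty ((Fil p ⧸ (Fil (p + 1)).addSubgroupOf (Fil p)) ≃+ (E.page r hr).X (p, q))

/-! ### The spectral object of morphisms to the shifts of a fixed object -/

/-! Write `R = ℤ[G]` and let `S` be the singular chain complex of the universal covering. A deck
transformation with a fixed point is the identity, so `G` permutes the singular simplices of each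
dimension freely. Hence each `Sₙ` is the permutation module of a free action and is projective
(`permutationModule.projective`). A bounded above complex of projectives is K-projective, so the
cohomology of `Hom(S, M)` is the group of morphisms `S ⟶ M[n]` in the derived category of `R`
(`homologyHomComplexAddEquivHom`).

The spectral sequence comes from the canonical truncations of `S`. They form a spectral object in
the triangulated sense, and morphisms into the shifts of `M` turn it into a spectral object of
abelian groups with reversed indexing (`homTruncSpectralObject`). The layer of `S` in cohomological
degree `-q` is `H_q(S)[q]`, and `Hom(H_q(S)[q], M[p + q]) = Ext^p(H_q(S), M)` is the second page. As
`S` lives in nonpositive degrees and `M` in degree zero, the spectral object lies in the first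
quadrant. On late pages an entry is therefore the image of a map that factors through the abutment,
which makes it a graded piece of the filtration of the abutment by images
(`convergesTo_E₂SpectralSequenceNat`).

In total degree one, `E₂^{0,1} = Hom(H₁, M)` vanishes because a simply connected space has `H₁ = 0`.
So `H¹` is `E₂^{1,0} = Ext¹(H₀, M)`, and the augmentation identifies `H₀` with the trivial module
`ℤ`. Both homology groups are computed directly, by joining every point to a base point by a path.
-/

/-- The homomorphism between small models of groups induced by a homomorphism. -/
noncomputable def AddMonoidHom.shrink {A B : Type*} [AddCommGroup A] [AddCommGroup B] [Small.{u} A]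
    [Small.{u} B] (f : A →+ B) : Shrink.{u} A →+ Shrink.{u} B :=
  (Shrink.addEquiv (α := B)).symm.toAddMonoidHom.comp
    (f.comp (Shrink.addEquiv (α := A)).toAddMonoidHom)

namespace CategoryTheory

open ComposableArrows Limits Pretriangulated Triangulated Pretriangulated.Opposite

theorem exact_mk₂_ofHom_shrink {A B C : Type*} [AddCommGroup A] [AddCommGroup B] [AddCommGroup C]
    [Small.{u} A] [Small.{u} B] [Small.{u} C] (f : A →+ B) (g : B →+ C)
    (h : Function.Exact f g) :
    (mk₂ (AddCommGrpCat.ofHom f.shrink)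
      (AddCommGrpCat.ofHom (AddMonoidHom.shrink.{u} g))).Exact := by
  have hfg (x : Shrink.{u} A) : g.shrink (f.shrink x) = 0 := by
    simp [AddMonoidHom.shrink, h.apply_apply_eq_zero]
  let S : ShortComplex AddCommGrpCat.{u} :=
    ShortComplex.mk (AddCommGrpCat.ofHom f.shrink) (AddCommGrpCat.ofHom g.shrink)
      (AddCommGrpCat.hom_ext (AddMonoidHom.ext hfg))
  have hS : S.Exact := by
    rw [ShortComplex.ab_exact_iff]
    intro (x : Shrink.{u} B) (hx : g.shrink x = 0)
    obtain ⟨y, hy⟩ := (h (Shrink.addEquiv x)).1 (by simpa [AddMonoidHom.shrink] using hx)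
    refine ⟨Shrink.addEquiv.symm y, ?_⟩
    change f.shrink _ = x
    simp [AddMonoidHom.shrink, hy]
  exact hS.exact_toComposableArrows

theorem ofHom_shrink_comp_eq {A B B' C : Type*} [AddCommGroup A] [AddCommGroup B] [AddCommGroup B']
    [AddCommGroup C] [Small.{u} A] [Small.{u} B] [Small.{u} B'] [Small.{u} C] (f : A →+ B)
    (g : B →+ C) (f' : A →+ B') (g' : B' →+ C) (h : ∀ x, g (f x) = g' (f' x)) :
    AddCommGrpCat.ofHom f.shrink ≫ AddCommGrpCat.ofHom (AddMonoidHom.shrink.{u} g) =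
      AddCommGrpCat.ofHom f'.shrink ≫ AddCommGrpCat.ofHom g'.shrink := by
  refine AddCommGrpCat.hom_ext (AddMonoidHom.ext fun (x : Shrink.{u} A) ↦ ?_)
  change g.shrink (f.shrink x) = g'.shrink (f'.shrink x)
  simp [AddMonoidHom.shrink, h]

namespace Triangulated.SpectralObject

variable {C : Type*} [Category* C] [HasZeroObject C]
  [HasShift C ℤ] [Preadditive C] [∀ (n : ℤ), (shiftFunctor C n).Additive] [Pretriangulated C]
  {ι ι' : Type*} [Preorder ι] [Preorder ι'] (T : SpectralObject C ι) {ρ : ι' → ι} (hρ : Antitone ρ)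
  (Y : C)

/-- The reflection of an arrow under an antitone map. -/
def reflect (D : ComposableArrows ι' 1) : ComposableArrows ι 1 :=
  mk₁ (homOfLE (hρ (leOfHom (D.map' 0 1))))

/-- The reflection of a morphism of arrows under an antitone map. -/
def reflectMap {D D' : ComposableArrows ι' 1} (φ : D ⟶ D') :
    reflect hρ D' ⟶ reflect hρ D :=
  homMk₁ (homOfLE (hρ (leOfHom (φ.app 1)))) (homOfLE (hρ (leOfHom (φ.app 0))))

/-- The connecting homomorphism for morphisms to shifts of a fixed object. -/
noncomputable def homδ {i j k : ι} (f : i ⟶ j) (g : j ⟶ k) (n₀ n₁ : ℤ) (h : n₀ + 1 = n₁) :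
    (T.ω₁.obj (mk₁ f) ⟶ Y⟦n₀⟧) →+ (T.ω₁.obj (mk₁ g) ⟶ Y⟦n₁⟧) :=
  AddMonoidHom.mk' (fun x ↦ T.δ f g ≫ x⟦(1 : ℤ)⟧' ≫ (shiftFunctorAdd' C n₀ 1 n₁ h).inv.app Y)
    (by simp)

variable {i j k : ι} (f : i ⟶ j) (g : j ⟶ k)

/-- This and the next two results are the long exact sequence of the contravariant functor `Hom(-,
Y)` on the triangle of `f` and `g`, read in the opposite category. `key` identifies the connecting
map there with `homδ`. -/
theorem exact_homδ_leftComp (n₀ n₁ : ℤ) (h : n₀ + 1 = n₁) :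
    Function.Exact (T.homδ Y f g n₀ n₁ h)
      (Preadditive.leftComp (Y⟦n₁⟧) (T.ω₁.map (twoδ₁Toδ₀ f g _ rfl))) := by
  have := (ShortComplex.ab_exact_iff_function_exact _).1
    ((preadditiveYoneda.obj Y).homologySequence_exact₁ _
    (op_distinguished _ (T.triangle_distinguished f g)) n₀ n₁ h)
  have key (x) := preadditiveYoneda_homologySequenceδ_apply (T.triangle f g) n₀ n₁ h (B := Y) x
  exact fun y ↦ (this y).trans ⟨fun ⟨x, hx⟩ ↦ ⟨x, (key x).symm.trans hx⟩,
    fun ⟨x, hx⟩ ↦ ⟨x, (key x).trans hx⟩⟩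

theorem exact_leftComp_leftComp (n : ℤ) :
    Function.Exact (Preadditive.leftComp (Y⟦n⟧) (T.ω₁.map (twoδ₁Toδ₀ f g _ rfl)))
      (Preadditive.leftComp (Y⟦n⟧) (T.ω₁.map (twoδ₂Toδ₁ f g _ rfl))) :=
  (ShortComplex.ab_exact_iff_function_exact _).1
    ((preadditiveYoneda.obj Y).homologySequence_exact₂ _
    (op_distinguished _ (T.triangle_distinguished f g)) n)

theorem exact_leftComp_homδ (n₀ n₁ : ℤ) (h : n₀ + 1 = n₁) :
    Function.Exact (Preadditive.leftComp (Y⟦n₀⟧) (T.ω₁.map (twoδ₂Toδ₁ f g _ rfl)))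
      (T.homδ Y f g n₀ n₁ h) := by
  have := (ShortComplex.ab_exact_iff_function_exact _).1
    ((preadditiveYoneda.obj Y).homologySequence_exact₃ _
    (op_distinguished _ (T.triangle_distinguished f g)) n₀ n₁ h)
  have key (x) := preadditiveYoneda_homologySequenceδ_apply (T.triangle f g) n₀ n₁ h (B := Y) x
  exact fun y ↦ (Eq.congr_left (key y).symm).trans (this y)

theorem homδ_naturality {i' j' k' : ι} (f' : i' ⟶ j') (g' : j' ⟶ k') (hi : i ⟶ i') (hj : j ⟶ j')
    (hk : k ⟶ k') (n₀ n₁ : ℤ) (h : n₀ + 1 = n₁) (x : T.ω₁.obj (mk₁ f') ⟶ Y⟦n₀⟧) :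
    T.homδ Y f g n₀ n₁ h (T.ω₁.map (homMk₁ hi hj : mk₁ f ⟶ mk₁ f') ≫ x) =
      T.ω₁.map (homMk₁ hj hk : mk₁ g ⟶ mk₁ g') ≫ T.homδ Y f' g' n₀ n₁ h x := by
  have : T.ω₁.map (homMk₁ hj hk : mk₁ g ⟶ mk₁ g') ≫ T.δ f' g' =
      T.δ f g ≫ (T.ω₁.map (homMk₁ hi hj : mk₁ f ⟶ mk₁ f'))⟦(1 : ℤ)⟧' :=
    T.δ'.naturality (homMk₂ hi hj hk : mk₂ f g ⟶ mk₂ f' g')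
  simp [homδ, reassoc_of% this]

variable [∀ D n, Small.{u} (T.ω₁.obj D ⟶ Y⟦(n : ℤ)⟧)]

/-- The spectral object of the groups of morphisms from a spectral object in a triangulated category
to the shifts of a fixed object. It is indexed contravariantly. -/
noncomputable def homSpectralObject : Abelian.SpectralObject AddCommGrpCat.{u} ι' where
  H n :=
    { obj D := AddCommGrpCat.of (Shrink.{u} (T.ω₁.obj (reflect hρ D) ⟶ Y⟦n⟧))
      map φ := AddCommGrpCat.ofHom
        (Preadditive.leftComp (Y⟦n⟧) (T.ω₁.map (reflectMap hρ φ))).shrink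
      map_id D := by
        have : reflectMap hρ (𝟙 D) = 𝟙 _ := hom_ext₁ rfl rfl
        rw [this]
        ext x
        simp [AddMonoidHom.shrink, Preadditive.leftComp]
      map_comp φ ψ := by
        have : reflectMap hρ (φ ≫ ψ) = reflectMap hρ ψ ≫ reflectMap hρ φ := hom_ext₁ rfl rfl
        rw [this]
        ext x
        simp [AddMonoidHom.shrink, Preadditive.leftComp] }
  δ' n₀ n₁ h :=
    { app D := AddCommGrpCat.ofHom
        (T.homδ Y (homOfLE (hρ (leOfHom (D.map' 1 2)))) (homOfLE (hρ (leOfHom (D.map' 0 1))))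
          n₀ n₁ h).shrink
      naturality D D' φ := by
        exact ofHom_shrink_comp_eq _ _ _ _ fun x ↦
          T.homδ_naturality Y (homOfLE (hρ (leOfHom (D'.map' 1 2))))
          (homOfLE (hρ (leOfHom (D'.map' 0 1)))) (homOfLE (hρ (leOfHom (D.map' 1 2))))
          (homOfLE (hρ (leOfHom (D.map' 0 1)))) (homOfLE (hρ (leOfHom (φ.app 2))))
          (homOfLE (hρ (leOfHom (φ.app 1)))) (homOfLE (hρ (leOfHom (φ.app 0)))) n₀ n₁ h x }
  exact₁' n₀ n₁ h D := exact_mk₂_ofHom_shrink _ _ (T.exact_homδ_leftComp Y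
    (homOfLE (hρ (leOfHom (D.map' 1 2)))) (homOfLE (hρ (leOfHom (D.map' 0 1)))) n₀ n₁ h)
  exact₂' n D := exact_mk₂_ofHom_shrink _ _ (T.exact_leftComp_leftComp Y
    (homOfLE (hρ (leOfHom (D.map' 1 2)))) (homOfLE (hρ (leOfHom (D.map' 0 1)))) n)
  exact₃' n₀ n₁ h D := exact_mk₂_ofHom_shrink _ _ (T.exact_leftComp_homδ Y
    (homOfLE (hρ (leOfHom (D.map' 1 2)))) (homOfLE (hρ (leOfHom (D.map' 0 1)))) n₀ n₁ h)

end Triangulated.SpectralObject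
end CategoryTheory

/-! ### Convergence of the spectral sequence of a spectral object -/

section

variable {A A' T Q E : Type*} [AddCommGroup A] [AddCommGroup A'] [AddCommGroup T]
  [AddCommGroup Q] [AddCommGroup E]

/-- If `A → T → Q` has image `E` and `A' → T → Q` is exact, with the range of `A'` in that of `A`,
then `E` is the quotient of the ranges of `A` and `A'` in `T`. -/
theorem nonempty_range_quotient_addEquiv (a : A →+ T) (a' : A' →+ T) (b : T →+ Q) (s : A →+ E)
    (m : E →+ Q) (hs : Function.Surjective s) (hm : Function.Injective m)
    (h : ∀ x, m (s x) = b (a x)) (hex : a'.range = b.ker) :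
    Nonempty ((a.range ⧸ a'.range.addSubgroupOf a.range) ≃+ E) := by
  let π : A →+ a.range ⧸ a'.range.addSubgroupOf a.range :=
    (QuotientAddGroup.mk' _).comp a.rangeRestrict
  have hπ : Function.Surjective π :=
    (QuotientAddGroup.mk'_surjective _).comp a.rangeRestrict_surjective
  have hker : π.ker = s.ker := by
    ext x
    rw [AddMonoidHom.mem_ker, AddMonoidHom.mem_ker, ← map_eq_zero_iff m hm, h]
    change QuotientAddGroup.mk _ = _ ↔ _
    rw [QuotientAddGroup.eq_zero_iff, AddSubgroup.mem_addSubgroupOf, hex, AddMonoidHom.mem_ker]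
    rfl
  exact ⟨(QuotientAddGroup.quotientKerEquivOfSurjective π hπ).symm.trans
    ((QuotientAddGroup.quotientAddEquivOfEq hker).trans
      (QuotientAddGroup.quotientKerEquivOfSurjective s hs))⟩

end

namespace CategoryTheory.Abelian.SpectralObject

open ComposableArrows Limits

section

variable {C ι : Type*} [Category* C] [Abelian C] [Preorder ι] (Y : SpectralObject C ι)

/-- The map `H^n(i ≤ j) ⟶ H^n(i' ≤ j')` of a spectral object when `i ≤ i'` and `j ≤ j'`. -/
def mapOfLE (n : ℤ) {i j i' j' : ι} (h : i ≤ j) (h' : i' ≤ j') (hi : i ≤ i') (hj : j ≤ j') :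
    (Y.H n).obj (mk₁ (homOfLE h)) ⟶ (Y.H n).obj (mk₁ (homOfLE h')) :=
  (Y.H n).map (homMk₁ (homOfLE hi) (homOfLE hj))

theorem mapOfLE_comp (n : ℤ) {i j i' j' i'' j'' : ι} (h : i ≤ j) (h' : i' ≤ j') (h'' : i'' ≤ j'')
    (hi : i ≤ i') (hj : j ≤ j') (hi' : i' ≤ i'') (hj' : j' ≤ j'') :
    Y.mapOfLE n h h' hi hj ≫ Y.mapOfLE n h' h'' hi' hj' =
      Y.mapOfLE n h h'' (hi.trans hi') (hj.trans hj') :=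
  ((Y.H n).map_comp _ _).symm

theorem exact_mapOfLE (n : ℤ) {i j k : ι} (h : i ≤ j) (h' : j ≤ k) :
    (ShortComplex.mk (Y.mapOfLE n h (h.trans h') le_rfl h')
      (Y.mapOfLE n (h.trans h') h' h le_rfl) (Y.zero₂ (homOfLE h) (homOfLE h') _ rfl n)).Exact :=
  Y.exact₂ (homOfLE h) (homOfLE h') _ rfl n

/-- The cycles are a quotient of the left group and the opcycles embed in the right one. Thus `E` is
the image of the map between the two groups, the form in which it is compared with the abutment. -/
theorem exists_E_factorization {i₀ i₁ i₂ i₃ : ι} (h₀ : i₀ ≤ i₁) (h₁ : i₁ ≤ i₂) (h₂ : i₂ ≤ i₃)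
    (n₀ n₁ n₂ : ℤ) (hn₁ : n₀ + 1 = n₁) (hn₂ : n₁ + 1 = n₂) :
    ∃ (s : (Y.H n₁).obj (mk₁ (homOfLE (h₀.trans h₁))) ⟶
        Y.E (homOfLE h₀) (homOfLE h₁) (homOfLE h₂) n₀ n₁ n₂ hn₁ hn₂)
      (m : Y.E (homOfLE h₀) (homOfLE h₁) (homOfLE h₂) n₀ n₁ n₂ hn₁ hn₂ ⟶
        (Y.H n₁).obj (mk₁ (homOfLE (h₁.trans h₂)))),
      Epi s ∧ Mono m ∧ s ≫ m = Y.mapOfLE n₁ (h₀.trans h₁) (h₁.trans h₂) h₀ h₂ := by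
  refine ⟨Y.toCycles (homOfLE h₀) (homOfLE h₁) (homOfLE (h₀.trans h₁)) rfl n₁ ≫
    Y.πE _ _ _ _ _ _ hn₁ hn₂, Y.ιE _ _ _ _ _ _ hn₁ hn₂ ≫
      Y.fromOpcycles (homOfLE h₁) (homOfLE h₂) (homOfLE (h₁.trans h₂)) rfl n₁,
      epi_comp _ _, mono_comp _ _, ?_⟩
  rw [Category.assoc, Y.πE_ιE_assoc _ _ _ _ _ _ hn₁ hn₂, Y.toCycles_i_assoc, Y.p_fromOpcycles]
  exact Y.mapOfLE_comp n₁ (h₀.trans h₁) h₁ (h₁.trans h₂) h₀ le_rfl le_rfl h₂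

end

variable (Y : SpectralObject AddCommGrpCat.{u} EInt) [Y.IsFirstQuadrant]

theorem convergesTo_E₂SpectralSequenceNat :
    ConvergesTo Y.E₂SpectralSequenceNat
      (fun n ↦ (Y.H n).obj (mk₁ (homOfLE (bot_le : (⊥ : EInt) ≤ ⊤)))) := by
  intro n
  let a (i : EInt) := Y.mapOfLE n (bot_le : ⊥ ≤ i) bot_le le_rfl le_top
  let b (i : EInt) := Y.mapOfLE n (bot_le : ⊥ ≤ ⊤) (le_top : i ≤ ⊤) bot_le le_rfl
  have hab (i : EInt) : (a i).hom.range = (b i).hom.ker :=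
    ShortComplex.ab_exact_iff_range_eq_ker.1 (Y.exact_mapOfLE n (bot_le : ⊥ ≤ i) le_top)
  -- For `p + q = n` the index `n - p + 1` is `q + 1`. At `p = 0` it is `n + 1`, where `b` has zero
  -- target; at `p = n + 1` it is `0`, where `a` has zero source.
  refine ⟨fun p ↦ (a ((n - p + 1 : ℤ) : EInt)).hom.range, ?_, ?_, ?_, ?_⟩
  · intro p p' hpp'
    rintro _ ⟨x, rfl⟩
    have : ((n - p' + 1 : ℤ) : EInt) ≤ ((n - p + 1 : ℤ) : EInt) := by
      rw [WithBotTop.coe_le_coe]; lia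
    refine ⟨Y.mapOfLE n bot_le bot_le le_rfl this x, ?_⟩
    exact ConcreteCategory.congr_hom
      (Y.mapOfLE_comp n bot_le bot_le (bot_le : ⊥ ≤ ⊤) le_rfl this le_rfl le_top) x
  · dsimp only
    rw [hab, eq_top_iff]
    intro x _
    exact ((AddCommGrpCat.isZero_iff_subsingleton).1
      (Y.isZero₂_of_isFirstQuadrant _ _ _ n (by simp))).elim _ _
  · rw [eq_bot_iff]
    rintro _ ⟨x, rfl⟩
    have : Subsingleton ((Y.H n).obj (mk₁ (homOfLE
        (bot_le : ⊥ ≤ ((n - (n + 1 : ℕ) + 1 : ℤ) : EInt))))) :=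
      AddCommGrpCat.isZero_iff_subsingleton.1
        (Y.isZero₁_of_isFirstQuadrant _ _ _ (by simp) n)
    rw [Subsingleton.elim x 0, map_zero]
    exact zero_mem _
  · intro p q hpq r hr hp hq
    have h₁ : ((q : ℤ) : EInt) ≤ ((q + 1 : ℤ) : EInt) := by
      rw [WithBotTop.coe_le_coe]; lia
    obtain ⟨s, m, hs, hm, hsm⟩ := Y.exists_E_factorization (bot_le : ⊥ ≤ ((q : ℤ) : EInt)) h₁
      le_top (n - 1) n (n + 1) (by lia) rfl
    -- The bounds on `r` put the outer indices of the page in the ranges where the first quadrant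
    -- conditions apply, so they can be moved to `⊥` and `⊤` without changing `E`.
    have e := Y.spectralSequencePageXIso coreE₂CohomologicalNat r hr (p, q) _ _ _ _ rfl rfl rfl rfl
      (n - 1) n (n + 1) (by simp [← hpq]) ≪≫
      (Y.isoMapFourδ₁Toδ₀' ⊥ _ _ _ _ bot_le _ _ _ (n - 1) n (n + 1)
        (Y.isZero₁_of_isFirstQuadrant _ _ _ (by simp; lia) _) _ rfl).symm ≪≫
      Y.isoMapFourδ₄Toδ₃' _ _ _ _ ⊤ _ _ _ le_top (n - 1) n (n + 1)
        (Y.isZero₂_of_isFirstQuadrant _ _ _ _ (by simp; lia)) _ rfl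
    rw [AddCommGrpCat.epi_iff_surjective] at hs
    rw [AddCommGrpCat.mono_iff_injective] at hm
    have h (x) : m (s x) = b ((q : ℤ) : EInt) (a ((q + 1 : ℤ) : EInt) x) :=
      (ConcreteCategory.congr_hom hsm x).trans (ConcreteCategory.congr_hom
        (Y.mapOfLE_comp n bot_le (bot_le : ⊥ ≤ ⊤) le_top le_rfl le_top bot_le le_rfl) x).symm
    obtain ⟨e'⟩ := nonempty_range_quotient_addEquiv (a ((q + 1 : ℤ) : EInt)).hom
      (a ((q : ℤ) : EInt)).hom (b ((q : ℤ) : EInt)).hom s.hom m.hom hs hm h (hab _)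
    -- The indices occur in the types of `a i` and `a j`, so they are generalized before being
    -- replaced by `q + 1` and `q`.
    suffices ∀ i j : EInt, i = ((q + 1 : ℤ) : EInt) → j = ((q : ℤ) : EInt) →
        Nonempty (((a i).hom.range ⧸ (a j).hom.range.addSubgroupOf (a i).hom.range) ≃+
          (Y.E₂SpectralSequenceNat.page r hr).X (p, q)) from
      this _ _ (by congr 1; lia) (by congr 1; lia)
    rintro _ _ rfl rfl
    exact ⟨e'.trans e.symm.addCommGroupIsoToAddEquiv⟩

end CategoryTheory.Abelian.SpectralObject

/-! ### Morphisms in the derived category to a shifted single complex -/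

namespace DerivedCategory

universe w v u'

variable {C : Type u'} [Category.{v} C] [Abelian C] [HasDerivedCategory.{w} C]

/-- Morphisms from a K-projective complex to a shifted complex are the cohomology classes of the
complex of morphisms. -/
noncomputable def cohomologyClassAddEquivOfIsKProjective (K L : CochainComplex C ℤ)
    [K.IsKProjective] (n : ℤ) :
    CochainComplex.HomComplex.CohomologyClass K L n ≃+ (Q.obj K ⟶ (Q.obj L)⟦n⟧) :=
  (CochainComplex.HomComplex.CohomologyClass.homAddEquiv (K := K) (L := L) (n := n)).trans
    ((AddEquiv.ofBijective (Qh.mapAddHom (X := (HomotopyCategory.quotient _ _).obj K)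
      (Y := (HomotopyCategory.quotient _ _).obj (L⟦n⟧)))
      (CochainComplex.IsKProjective.Qh_map_bijective K _)).trans
    { toEquiv := Iso.homCongr ((quotientCompQhIso C).app K)
        ((quotientCompQhIso C).app (L⟦n⟧) ≪≫ (Q.commShiftIso n).app L)
      map_add' := by simp })

/-- An injective resolution of `M` is K-injective, so every such morphism comes from the homotopy
category, whose morphism sets are already in `Type v`. This lets the spectral object take values in
groups of that universe. -/
instance small_hom_shift_singleFunctor [EnoughInjectives C] (X : DerivedCategory C) (M : C)
    (n : ℤ) : Small.{v} (X ⟶ ((singleFunctor C 0).obj M)⟦n⟧) := by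
  let I : InjectiveResolution M := injectiveResolution M
  let e : ((singleFunctor C 0).obj M)⟦n⟧ ≅
      Qh.obj ((HomotopyCategory.quotient _ _).obj (I.cochainComplex⟦n⟧)) :=
    (shiftFunctor _ n).mapIso ((singleFunctorIsoCompQ C 0).app M ≪≫ asIso (Q.map I.ι')) ≪≫
      ((Q.commShiftIso n).app I.cochainComplex).symm ≪≫ ((quotientCompQhIso C).app _).symm
  let e' := (Iso.homCongr (Qh.objObjPreimageIso X) e.symm)
  exact small_of_surjective (e'.surjective.comp
    (CochainComplex.IsKInjective.Qh_map_bijective _ _).surjective)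

end DerivedCategory

/-! ### Cohomology of `Hom(S, M)` as cohomology classes of cocycles -/

section

universe v u'

variable {C : Type u'} [Category.{v} C] [Abelian C]

open CochainComplex.HomComplex

variable (S : ChainComplex C ℕ) (M : C)

/-- The objects of the extension of a chain complex to a cochain complex indexed by `ℤ`. -/
noncomputable def ChainComplex.extendXNegIso (n : ℕ) :
    (S.extend ComplexShape.embeddingDownNat).X (-(n : ℤ)) ≅ S.X n :=
  S.extendXIso ComplexShape.embeddingDownNat rfl

theorem ChainComplex.extend_d_neg (m n : ℕ) :
    (S.extend ComplexShape.embeddingDownNat).d (-(m : ℤ)) (-(n : ℤ)) =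
      (extendXNegIso S m).hom ≫ S.d m n ≫ (extendXNegIso S n).inv :=
  S.extend_d_eq ComplexShape.embeddingDownNat rfl rfl

open ChainComplex

/-- The cohomology class of a cocycle in `Hom(S, M)`. -/
noncomputable def homCocyclesToCohomologyClass (n : ℕ) :
    (Preadditive.leftComp M (S.d (n + 1) n)).ker →+
      CohomologyClass (S.extend ComplexShape.embeddingDownNat)
        ((CochainComplex.singleFunctor C 0).obj M) n :=
  have h (f : (Preadditive.leftComp M (S.d (n + 1) n)).ker) :
      (S.extend ComplexShape.embeddingDownNat).d (-(n + 1 : ℕ)) (-(n : ℕ)) ≫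
        (extendXNegIso S _).hom ≫ f.1 = 0 := by
    rw [extend_d_neg S]
    have : S.d (n + 1) n ≫ f.1 = 0 := f.2
    simp [this]
  AddMonoidHom.mk' (fun f ↦ .mk (Cocycle.toSingleMk _ (by simp) _ (by lia) (h f)))
    (fun f g ↦ by
      rw [← CohomologyClass.mk_add, ← Cocycle.toSingleMk_add]
      simp only [AddSubgroup.coe_add, Preadditive.comp_add])

theorem homCocyclesToCohomologyClass_surjective (n : ℕ) :
    Function.Surjective (homCocyclesToCohomologyClass S M n) := by
  intro x
  obtain ⟨x, rfl⟩ := x.mk_surjective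
  obtain ⟨f, hf, rfl⟩ := Cocycle.toSingleMk_surjective x (-(n : ℕ)) (by simp) (-(n + 1 : ℕ))
    (by lia)
  refine ⟨⟨(extendXNegIso S _).inv ≫ f, ?_⟩, ?_⟩
  · rw [extend_d_neg S] at hf
    change S.d (n + 1) n ≫ _ = 0
    rw [← cancel_epi (extendXNegIso S (n + 1)).hom, Limits.comp_zero, ← hf]
    simp only [Category.assoc]
  · simp [homCocyclesToCohomologyClass]

theorem homCocyclesToCohomologyClass_eq_zero_iff (n : ℕ)
    (f : (Preadditive.leftComp M (S.d (n + 1) n)).ker) :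
    homCocyclesToCohomologyClass S M n f = 0 ↔
      ∃ g, S.d n ((ComplexShape.up ℕ).prev n) ≫ g = f.1 := by
  refine (CohomologyClass.mk_eq_zero_iff _).trans
    ((Cocycle.toSingleMk_mem_coboundaries_iff _ _ _ _ _ (-(n : ℤ) + 1) rfl).trans ?_)
  obtain _ | n := n
  -- In degree zero there are no coboundaries: `prev 0` is the default value `0`, where `S.d 0 0 =
  -- 0`, and the extended complex vanishes in degree `1`. Both sides say that `f` is zero.
  · have : S.d 0 ((ComplexShape.up ℕ).prev 0) = 0 := S.shape _ _ (by simp)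
    have h0 : (S.extend ComplexShape.embeddingDownNat).d (-(0 : ℕ)) (-(0 : ℕ) + 1) = 0 :=
      Limits.IsZero.eq_of_tgt (S.isZero_extend_X _ _ (by intro i; simp; lia)) _ _
    simp only [this, h0, Limits.zero_comp, exists_const_iff]
    exact ⟨fun ⟨_, h⟩ ↦ ⟨⟨0⟩, by rwa [eq_comm, Preadditive.IsIso.comp_left_eq_zero, eq_comm] at h⟩,
      fun ⟨_, h⟩ ↦ ⟨⟨0⟩, by rw [← h, Limits.comp_zero]⟩⟩
  · have h1 : (-(n + 1 : ℕ) + 1 : ℤ) = - (n : ℤ) := by lia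
    rw [h1, extend_d_neg S,
      CochainComplex.prev_nat_succ]
    refine ⟨fun ⟨g, hg⟩ ↦ ⟨(extendXNegIso S _).inv ≫ g, ?_⟩,
      fun ⟨g, hg⟩ ↦ ⟨(extendXNegIso S _).hom ≫ g, ?_⟩⟩
    · rw [← cancel_epi (extendXNegIso S (n + 1)).hom, ← hg]
      simp only [Category.assoc]
    · simp [hg]

end

section

universe u'

variable {C : Type u'} [Category.{u} C] [Abelian C] (S : ChainComplex C ℕ) (M : C)

open CochainComplex.HomComplex

/-- The cohomology of `Hom(S, M)` as cohomology classes. -/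
noncomputable def homologyHomComplexAddEquiv (n : ℕ) :
    (homComplex S M).homology n ≃+ CohomologyClass (S.extend ComplexShape.embeddingDownNat)
        ((CochainComplex.singleFunctor C 0).obj M) n :=
  let T := (homComplex S M).sc' ((ComplexShape.up ℕ).prev n) n (n + 1)
  ((homComplex S M).homologyIsoSc' _ n (n + 1) rfl (by simp) ≪≫
    T.abHomologyIso).addCommGroupIsoToAddEquiv.trans
    ((QuotientAddGroup.quotientAddEquivOfEq (by
      ext f
      refine Iff.trans ?_ (homCocyclesToCohomologyClass_eq_zero_iff S M n f).symm
      exact ⟨fun ⟨g, hg⟩ ↦ ⟨g, congrArg Subtype.val hg⟩, fun ⟨g, hg⟩ ↦ ⟨g, Subtype.ext hg⟩⟩)).trans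
      (QuotientAddGroup.quotientKerEquivOfSurjective _
        (homCocyclesToCohomologyClass_surjective S M n)))

/-- For a complex `S` of projectives, the cohomology of `Hom(S, M)` as morphisms in the derived
category. -/
noncomputable def homologyHomComplexAddEquivHom [HasDerivedCategory C] [∀ n, Projective (S.X n)]
    (n : ℕ) :
    (homComplex S M).homology n ≃+ (DerivedCategory.Q.obj
      (S.extend ComplexShape.embeddingDownNat) ⟶
        ((DerivedCategory.singleFunctor C 0).obj M)⟦(n : ℤ)⟧) :=
  (homologyHomComplexAddEquiv S M n).trans
    -- Projectivity of the terms enters here: the extended complex is bounded above, hence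
    -- K-projective.
    (DerivedCategory.cohomologyClassAddEquivOfIsKProjective _ _ _)

end

/-! ### The spectral sequence from the truncations of an object of the derived category -/

/-- The reflection `n ↦ 1 - n` of the extended integers. -/
def reflectEInt : EInt → EInt := WithBotTop.rec ⊤ (fun n : ℤ ↦ ((1 - n : ℤ) : EInt)) ⊥

@[simp]
theorem reflectEInt_bot : reflectEInt ⊥ = ⊤ := rfl

@[simp]
theorem reflectEInt_top : reflectEInt ⊤ = ⊥ := rfl

@[simp]
theorem reflectEInt_coe (n : ℤ) : reflectEInt n = ((1 - n : ℤ) : EInt) := rfl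

theorem antitone_reflectEInt : Antitone reflectEInt := by
  intro a b h
  induction a using WithBotTop.rec <;> induction b using WithBotTop.rec <;> (simp at h ⊢; try lia)

/-- Composition with isomorphisms on both sides as an additive equivalence. -/
def CategoryTheory.Iso.homCongrAddEquiv {C : Type*} [Category* C] [Preadditive C] {X Y X' Y' : C}
    (e : X ≅ X') (f : Y ≅ Y') : (X ⟶ Y) ≃+ (X' ⟶ Y') where
  toEquiv := Iso.homCongr e f
  map_add' := by simp

namespace DerivedCategory

universe w v u'

variable {C : Type u'} [Category.{v} C] [Abelian C] [HasDerivedCategory.{w} C]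

open Pretriangulated

/-- In the long exact sequence of the truncation triangle the neighbouring terms are the cohomology
of the `≥ n` truncation in degrees `m - 1` and `m`, which vanishes. -/
theorem isIso_homologyFunctor_map_eTruncLTι (X : DerivedCategory C) (m n : ℤ) (h : m < n) :
    IsIso ((homologyFunctor C m).map ((TStructure.t.eTruncLTι (n : EInt)).app X)) := by
  have hT := TStructure.t.eTriangleLTGE_distinguished (n : EInt) X
  have : TStructure.t.IsGE ((TStructure.t.eTruncGE.obj (n : EInt)).obj X) n :=
    TStructure.t.isGE_eTruncGE_obj_obj n n le_rfl X
  have h₁ : Epi ((homologyFunctor C m).map ((TStructure.t.eTruncLTι (n : EInt)).app X)) :=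
    (HomologySequence.epi_homologyMap_mor₁_iff _ hT m).2
      ((isZero_of_isGE ((TStructure.t.eTruncGE.obj (n : EInt)).obj X) n m h).eq_of_tgt _ _)
  have h₂ : Mono ((homologyFunctor C m).map ((TStructure.t.eTruncLTι (n : EInt)).app X)) :=
    (HomologySequence.mono_homologyMap_mor₁_iff _ hT (m - 1) m (by lia)).2
      ((isZero_of_isGE ((TStructure.t.eTruncGE.obj (n : EInt)).obj X) n (m - 1)
        (by lia)).eq_of_src _ _)
  exact isIso_of_mono_of_epi _

theorem isIso_homologyFunctor_map_eTruncGEπ (X : DerivedCategory C) (m n : ℤ) (h : n ≤ m) :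
    IsIso ((homologyFunctor C m).map ((TStructure.t.eTruncGEπ (n : EInt)).app X)) := by
  have hT := TStructure.t.eTriangleLTGE_distinguished (n : EInt) X
  have : TStructure.t.IsLE ((TStructure.t.eTruncLT.obj (n : EInt)).obj X) (n - 1) :=
    TStructure.t.isLE_eTruncLT_obj_obj (n - 1) n (by simp) X
  have h₁ : Mono ((homologyFunctor C m).map ((TStructure.t.eTruncGEπ (n : EInt)).app X)) :=
    (HomologySequence.mono_homologyMap_mor₂_iff _ hT m).2
      ((isZero_of_isLE ((TStructure.t.eTruncLT.obj (n : EInt)).obj X) (n - 1) m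
        (by lia)).eq_of_src _ _)
  have h₂ : Epi ((homologyFunctor C m).map ((TStructure.t.eTruncGEπ (n : EInt)).app X)) :=
    (HomologySequence.epi_homologyMap_mor₂_iff _ hT m (m + 1) rfl).2
      ((isZero_of_isLE ((TStructure.t.eTruncLT.obj (n : EInt)).obj X) (n - 1) (m + 1)
        (by lia)).eq_of_tgt _ _)
  exact isIso_of_mono_of_epi _

/-- An object concentrated in degree `-q` is its cohomology shifted by `q`; the shift by `q` is
fully faithful and cancels, leaving morphisms into `M[p]`. -/
theorem nonempty_hom_addEquiv_ext [HasExt.{v} C] (W : DerivedCategory C) (M : C) (p q : ℕ) (n : ℤ)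
    (hn : n = p + q) [W.IsGE (-q)] [W.IsLE (-q)] :
    Nonempty ((W ⟶ ((singleFunctor C 0).obj M)⟦n⟧) ≃+
      Abelian.Ext.{v} ((homologyFunctor C (-q)).obj W) M p) := by
  obtain ⟨Z, ⟨e⟩⟩ := W.exists_iso_singleFunctor_obj_of_isGE_of_isLE (-(q : ℤ))
  let e' : (homologyFunctor C (-q)).obj W ≅ Z :=
    (homologyFunctor C (-q)).mapIso e ≪≫ (singleFunctorCompHomologyFunctorIso C (-q)).app Z
  let s : (singleFunctor C (-q)).obj Z ≅
    ((singleFunctor C 0).obj ((homologyFunctor C (-q)).obj W))⟦(q : ℤ)⟧ :=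
    (((singleFunctors C).shiftIso (q : ℤ) (-q) 0 (by lia)).symm.app Z) ≪≫
      (shiftFunctor _ (q : ℤ)).mapIso ((singleFunctor C 0).mapIso e'.symm)
  let t : ((singleFunctor C 0).obj M)⟦n⟧ ≅ (((singleFunctor C 0).obj M)⟦(p : ℤ)⟧)⟦(q : ℤ)⟧ :=
    (shiftFunctorAdd' _ (p : ℤ) q n hn.symm).app _
  exact ⟨(Iso.homCongrAddEquiv (e ≪≫ s) t).trans
    ((AddEquiv.ofBijective (shiftFunctor _ (q : ℤ)).mapAddHom
      ⟨Functor.map_injective _, Functor.map_surjective _⟩).symm.trans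
      Abelian.Ext.homAddEquiv.symm)⟩

end DerivedCategory

/-! ### Morphisms out of the truncations: first quadrant vanishing and second page -/

namespace DerivedCategory

open Pretriangulated Abelian ComposableArrows

universe w v u'

variable {C : Type u'} [Category.{v} C] [Abelian C] [HasDerivedCategory.{w} C]
  [EnoughInjectives C] (X : DerivedCategory C) (M : C)

/-- The spectral object of the morphisms from the truncations of `X` to the shifts of `M`. -/
noncomputable def homTruncSpectralObject : Abelian.SpectralObject AddCommGrpCat.{v} EInt :=
  (TStructure.t.spectralObject X).homSpectralObject antitone_reflectEInt ((singleFunctor C 0).obj M)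

/-- The values of `homTruncSpectralObject` as groups of morphisms. -/
noncomputable def homTruncSpectralObjectAddEquiv (n : ℤ) {i j : EInt} (hij : i ≤ j) :
    ((homTruncSpectralObject X M).H n).obj (mk₁ (homOfLE hij)) ≃+
      ((TStructure.t.eTruncGE.obj (reflectEInt j)).obj
        ((TStructure.t.eTruncLT.obj (reflectEInt i)).obj X) ⟶ ((singleFunctor C 0).obj M)⟦n⟧) :=
  Shrink.addEquiv

-- `M[n]` is concentrated in degree `-n`, strictly above the degrees of `W`, so the orthogonality of
-- the t-structure applies.
omit [EnoughInjectives C] in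
theorem subsingleton_hom_shift_singleFunctor (W : DerivedCategory C) (n : ℤ) (h : W.IsLE (-n - 1)) :
    Subsingleton (W ⟶ ((singleFunctor C 0).obj M)⟦n⟧) := by
  have : TStructure.t.IsGE (((singleFunctor C 0).obj M)⟦n⟧) (-n) :=
    TStructure.t.isGE_shift _ 0 n _ (by lia)
  exact subsingleton_of_forall_eq 0 fun f ↦ TStructure.t.zero f (-n - 1) (-n) (by lia)

/-- If `j ≤ 0`, its reflection is at least `1`, and truncating an object of degrees `≤ 0` there
gives zero. If `n < i`, the truncation below `1 - i` lives in degrees `≤ -n - 1` and has no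
morphisms to `M[n]`. -/
instance [X.IsLE 0] : (homTruncSpectralObject X M).IsFirstQuadrant where
  isZero₁ i j hij hj n := by
    rw [AddCommGrpCat.isZero_iff_subsingleton,
      (homTruncSpectralObjectAddEquiv X M n hij).toEquiv.subsingleton_congr]
    have h : Limits.IsZero ((TStructure.t.eTruncGE.obj (reflectEInt j)).obj
        ((TStructure.t.eTruncLT.obj (reflectEInt i)).obj X)) :=
      TStructure.t.isZero_eTruncGE_obj_obj _ 0 _ (by
        have := antitone_reflectEInt hj
        refine lt_of_lt_of_le ?_ this
        simp)
    exact subsingleton_of_forall_eq 0 fun f ↦ h.eq_of_src _ _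
  isZero₂ i j hij n hi := by
    rw [AddCommGrpCat.isZero_iff_subsingleton,
      (homTruncSpectralObjectAddEquiv X M n hij).toEquiv.subsingleton_congr]
    have h : TStructure.t.IsLE ((TStructure.t.eTruncLT.obj (reflectEInt i)).obj X) (-n - 1) :=
      TStructure.t.isLE_eTruncLT_obj_obj _ _ (by
        induction i using WithBotTop.rec <;> simp at hi ⊢
        lia) X
    exact subsingleton_hom_shift_singleFunctor M _ n inferInstance

/-- The reflection sends the interval from `q` to `q + 1` to that from `-q` to `1 - q`, which cuts
out exactly the cohomology of `X` in degree `-q`. -/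
theorem nonempty_homTruncSpectralObject_addEquiv_ext [HasExt.{v} C] (p q : ℕ) (n : ℤ)
    (hn : n = p + q) (h : ((q : ℤ) : EInt) ≤ ((q + 1 : ℤ) : EInt)) :
    Nonempty (((homTruncSpectralObject X M).H n).obj (mk₁ (homOfLE h)) ≃+
      Ext.{v} ((homologyFunctor C (-q)).obj X) M p) := by
  let V := (TStructure.t.eTruncLT.obj ((1 - q : ℤ) : EInt)).obj X
  let W := (TStructure.t.eTruncGE.obj ((1 - (q + 1) : ℤ) : EInt)).obj V
  have : TStructure.t.IsLE V (-q) :=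
    TStructure.t.isLE_eTruncLT_obj_obj _ _ (by simp [sub_eq_neg_add]) X
  have : W.IsLE (-q) := inferInstanceAs (TStructure.t.IsLE ((TStructure.t.eTruncGE.obj _).obj V) _)
  have : W.IsGE (-q) := TStructure.t.isGE_eTruncGE_obj_obj _ _ (by simp) V
  have := isIso_homologyFunctor_map_eTruncLTι X (-q) (1 - q) (by lia)
  have := isIso_homologyFunctor_map_eTruncGEπ V (-q) (1 - (q + 1)) (by lia)
  let e : (homologyFunctor C (-q)).obj W ≅ (homologyFunctor C (-q)).obj X :=
    (asIso ((homologyFunctor C (-q)).map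
      ((TStructure.t.eTruncGEπ ((1 - (q + 1) : ℤ) : EInt)).app V))).symm ≪≫
      asIso ((homologyFunctor C (-q)).map ((TStructure.t.eTruncLTι ((1 - q : ℤ) : EInt)).app X))
  obtain ⟨f⟩ := nonempty_hom_addEquiv_ext W M p q n hn
  exact ⟨(homTruncSpectralObjectAddEquiv X M n h).trans (f.trans
    ((((extFunctor p).mapIso e.symm.op).app M).addCommGroupIsoToAddEquiv))⟩

end DerivedCategory

/-- Convergence to isomorphic groups. -/
theorem ConvergesTo.of_addEquiv {E : E₂CohomologicalSpectralSequenceNat AddCommGrpCat.{u}}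
    {H H' : ℕ → AddCommGrpCat.{u}} (h : ConvergesTo E H) (e : ∀ n, H n ≃+ H' n) :
    ConvergesTo E H' := by
  intro n
  obtain ⟨Fil, h₁, h₂, h₃, h₄⟩ := h n
  refine ⟨fun p ↦ (Fil p).map (e n).toAddMonoidHom, fun a b hab ↦ AddSubgroup.map_mono (h₁ hab),
    ?_, by simp [h₃], fun p q hpq r hr hp hq ↦ ?_⟩
  · simp [h₂]
  · obtain ⟨f⟩ := h₄ p q hpq r hr hp hq
    refine ⟨AddEquiv.trans (AddEquiv.symm (QuotientAddGroup.congr _ _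
      ((e n).addSubgroupMap (Fil p)) ?_)) f⟩
    ext ⟨x, hx⟩
    refine ⟨?_, fun ⟨y, hy, hxy⟩ ↦ ⟨⟨y, h₁ p.le_succ hy⟩, hy, Subtype.ext hxy⟩⟩
    rintro ⟨⟨y, hy⟩, hy', hxy⟩
    exact ⟨y, hy', congrArg Subtype.val hxy⟩

namespace DerivedCategory

open Pretriangulated Abelian ComposableArrows

universe w v u'

/-- The spectral sequence of the extensions of the homology of an object of the derived category. -/
theorem exists_spectralSequence_ext {C : Type u'} [Category.{v} C] [Abelian C]
    [HasDerivedCategory.{w} C] [EnoughInjectives C] [HasExt.{v} C]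
    (X : DerivedCategory C) [X.IsLE 0] (M : C) (H : ℕ → AddCommGrpCat.{v})
    (e : ∀ n : ℕ, H n ≃+ (X ⟶ ((singleFunctor C 0).obj M)⟦(n : ℤ)⟧)) :
    ∃ S : E₂CohomologicalSpectralSequenceNat AddCommGrpCat.{v},
      (∀ i j : ℕ, Nonempty ((S.page 2 le_rfl).X (i, j) ≃+
        Ext.{v} ((homologyFunctor C (-j)).obj X) M i)) ∧ ConvergesTo S H := by
  refine ⟨(homTruncSpectralObject X M).E₂SpectralSequenceNat, fun i j ↦ ?_,
    ConvergesTo.of_addEquiv (SpectralObject.convergesTo_E₂SpectralSequenceNat _)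
      (fun n ↦ (homTruncSpectralObjectAddEquiv X M n _).trans (e n).symm)⟩
  have h : ((j : ℤ) : EInt) ≤ ((j + 1 : ℤ) : EInt) := by simp
  obtain ⟨f⟩ := nonempty_homTruncSpectralObject_addEquiv_ext X M i j _ rfl h
  exact ⟨((homTruncSpectralObject X M).spectralSequenceFirstPageXIso
    SpectralObject.coreE₂CohomologicalNat (i, j) _ _ rfl rfl _
      rfl).addCommGroupIsoToAddEquiv.trans f⟩

end DerivedCategory

/-! ### Permutation modules -/

namespace Rep

variable {G : Type u} [Group G]

/-- The module over the group ring spanned by a set with an action. -/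
noncomputable def permutationModule (X : Action (Type u) G) : ModuleCat.{u} (MonoidAlgebra ℤ G) :=
  (linearization ℤ G ⋙ toModuleMonoidAlgebra).obj X

/-- The basis elements of a permutation module. -/
noncomputable def permutationModule.basis {X : Action (Type u) G} (x : X.V) : permutationModule X :=
  (MonoidAlgebra.single x 1 : MonoidAlgebra ℤ X.V)

variable {X : Action (Type u) G} {N : ModuleCat.{u} (MonoidAlgebra ℤ G)}

open permutationModule

theorem permutationModule.closure_range_basis :
    AddSubgroup.closure (Set.range (basis (X := X))) = ⊤ := by
  refine eq_top_iff.2 fun v _ ↦ ?_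
  refine MonoidAlgebra.induction_linear (M := X.V) (R := ℤ)
    (motive := fun v ↦ v ∈ AddSubgroup.closure (Set.range (basis (X := X)))) v
    (zero_mem (AddSubgroup.closure (Set.range (basis (X := X)))))
    (fun _ _ h h' ↦ (AddSubgroup.closure (Set.range (basis (X := X)))).add_mem h h') fun x a ↦ ?_
  have : (MonoidAlgebra.single x a : MonoidAlgebra ℤ X.V) = a • basis (X := X) x := by
    refine Eq.trans ?_ (MonoidAlgebra.smul_single a x (1 : ℤ)).symm
    simp
  rw [this]
  exact AddSubgroup.zsmul_mem _ (AddSubgroup.subset_closure (Set.mem_range_self x)) _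

theorem permutationModule.smul_basis (g : G) (x : X.V) :
    MonoidAlgebra.of ℤ G g • basis x = basis (X.ρ g x) := by
  exact (Representation.single_smul (Representation.linearize ℤ G X) (1 : ℤ) g _).trans
    ((one_smul ℤ _).trans (Representation.linearize_single g x))

/-- Homomorphisms from a permutation module are determined on the basis. -/
theorem permutationModule.hom_ext {f f' : permutationModule X ⟶ N}
    (h : ∀ x : X.V, f (basis x) = f' (basis x)) : f = f' := by
  refine ModuleCat.hom_ext (LinearMap.toAddMonoidHom_injective ?_)
  refine AddMonoidHom.eq_of_eqOn_dense (closure_range_basis (X := X)) ?_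
  rintro _ ⟨x, rfl⟩
  exact h x

/-- The additive extension of a map on the basis of a permutation module. -/
noncomputable def permutationModule.descAddMonoidHom {A : Type*} [AddCommGroup A] (φ : X.V → A) :
    permutationModule X →+ A :=
  (Finsupp.liftAddHom fun x ↦ zmultiplesHom A (φ x)).comp
    (MonoidAlgebra.coeffAddEquiv (R := ℤ) (M := X.V)).toAddMonoidHom

@[simp]
theorem permutationModule.descAddMonoidHom_basis {A : Type*} [AddCommGroup A] (φ : X.V → A)
    (x : X.V) : descAddMonoidHom φ (basis x) = φ x := by
  refine (Finsupp.liftAddHom_apply_single (fun x ↦ zmultiplesHom A (φ x)) x 1).trans ?_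
  simp

theorem permutationModule.descAddMonoidHom_smul (φ : X.V → N)
    (hφ : ∀ g x, φ (X.ρ g x) = MonoidAlgebra.of ℤ G g • φ x) (r : MonoidAlgebra ℤ G)
    (v : permutationModule X) : descAddMonoidHom φ (r • v) = r • descAddMonoidHom φ v := by
  have key (g : G) : (descAddMonoidHom φ).comp (DistribSMul.toAddMonoidHom
      (permutationModule X) (MonoidAlgebra.of ℤ G g)) =
        (DistribSMul.toAddMonoidHom N (MonoidAlgebra.of ℤ G g)).comp (descAddMonoidHom φ) := by
    refine AddMonoidHom.eq_of_eqOn_dense (closure_range_basis (X := X)) ?_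
    rintro _ ⟨x, rfl⟩
    change descAddMonoidHom φ (MonoidAlgebra.of ℤ G g • basis x) =
      MonoidAlgebra.of ℤ G g • descAddMonoidHom φ (basis x)
    rw [smul_basis, descAddMonoidHom_basis, descAddMonoidHom_basis, hφ]
  induction r using MonoidAlgebra.induction_on with
  | of g => exact DFunLike.congr_fun (key g) v
  | add r s hr hs => rw [add_smul, map_add, hr, hs, add_smul]
  | smul a r hr => rw [smul_assoc, map_zsmul, hr, smul_assoc]

/-- The homomorphism from a permutation module given by an equivariant map on the basis. -/
noncomputable def permutationModule.desc (φ : X.V → N)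
    (hφ : ∀ g x, φ (X.ρ g x) = MonoidAlgebra.of ℤ G g • φ x) : permutationModule X ⟶ N :=
  ModuleCat.ofHom
    { toFun := descAddMonoidHom φ
      map_add' := map_add _
      map_smul' := descAddMonoidHom_smul φ hφ }

@[simp]
theorem permutationModule.desc_basis (φ : X.V → N)
    (hφ : ∀ g x, φ (X.ρ g x) = MonoidAlgebra.of ℤ G g • φ x) (x : X.V) :
    desc φ hφ (basis x) = φ x :=
  descAddMonoidHom_basis φ x

/-- The functoriality of permutation modules. -/
noncomputable def permutationModule.map {Y : Action (Type u) G} (f : X ⟶ Y) :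
    permutationModule X ⟶ permutationModule Y :=
  (linearization ℤ G ⋙ toModuleMonoidAlgebra).map f

@[simp]
theorem permutationModule.map_basis {Y : Action (Type u) G} (f : X ⟶ Y) (x : X.V) :
    map f (basis x) = basis (f.hom x) :=
  Representation.linearizeMap_single f x 1

/-- The permutation module of a free action is projective. -/
theorem permutationModule.projective (hX : ∀ (g : G) (x : X.V), X.ρ g x = x → g = 1) :
    Projective (permutationModule X) where
  factors {N N'} f e he := by
    rw [ModuleCat.epi_iff_surjective] at he
    let s : Setoid X.V := ⟨fun x y ↦ ∃ g, X.ρ g x = y, fun x ↦ ⟨1, by simp⟩,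
      fun {x _} ⟨g, h⟩ ↦ ⟨g⁻¹, by simp [← h]⟩,
      fun {x _ _} ⟨g, h⟩ ⟨g', h'⟩ ↦ ⟨g' * g, by simp [← h', ← h]⟩⟩
    choose g hg using fun x : X.V ↦ (Quotient.mk_out (s := s) x)
    choose l hl using fun x : X.V ↦ he (f (basis x))
    -- Lifts are used only at one representative of each orbit and are then transported along the
    -- orbit by `g x`, which carries the representative to `x`.
    refine ⟨desc (fun x ↦ MonoidAlgebra.of ℤ G (g x) • l (Quotient.out (s := s) ⟦x⟧))
      fun h x ↦ ?_, hom_ext fun x ↦ ?_⟩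
    · have h₁ : (⟦X.ρ h x⟧ : Quotient s) = ⟦x⟧ := Quotient.sound (s := s) ⟨h⁻¹, by simp⟩
      -- Equivariance is where freeness is needed: both group elements carry the representative to
      -- `X.ρ h x`, so they agree.
      have h₂ : g (X.ρ h x) = h * g x := by
        have h₃ := hg (X.ρ h x)
        rw [h₁] at h₃
        have := hX ((h * g x)⁻¹ * g (X.ρ h x)) (Quotient.out (s := s) ⟦x⟧)
          (by
            rw [map_mul]
            change X.ρ (h * g x)⁻¹ (X.ρ (g (X.ρ h x)) _) = _
            have h₄ : X.ρ h x = X.ρ (h * g x) (Quotient.out (s := s) ⟦x⟧) := by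
              rw [map_mul]
              exact congrArg (X.ρ h) (hg x).symm
            rw [h₃, h₄, Action.ρ_inv_self_apply])
        rwa [inv_mul_eq_one, eq_comm] at this
      rw [h₁, h₂, map_mul, mul_smul]
    · rw [ModuleCat.comp_apply, desc_basis, map_smul, hl, ← map_smul, smul_basis, hg]

end Rep

/-! ### Freeness of the deck action -/

/-- In a covering with simply connected total space, a homotopy class of paths is determined by the
end point of a lift. -/
theorem IsCoveringMap.eq_of_monodromy_eq {E B : Type*} [TopologicalSpace E] [TopologicalSpace B]
    [SimplyConnectedSpace E] {p : E → B} (hp : IsCoveringMap p) {x y : B}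
    {γ γ' : Path.Homotopic.Quotient x y} (e : p ⁻¹' {x})
    (h : hp.monodromy γ e = hp.monodromy γ' e) : γ = γ' := by
  have key (a a' : p ⁻¹' {y}) (h : a = a') (L : Path.Homotopic.Quotient e.1 a.1)
      (L' : Path.Homotopic.Quotient e.1 a'.1) (hL : L.map ⟨p, hp.continuous⟩ = γ.cast e.2 a.2)
      (hL' : L'.map ⟨p, hp.continuous⟩ = γ'.cast e.2 a'.2) : γ = γ' := by
    subst h
    obtain ⟨e, rfl⟩ := e
    obtain ⟨a, rfl⟩ := a
    -- The lifts share their end points in a simply connected space, so they are homotopic, and `p`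
    -- carries the homotopy down.
    rw [Subsingleton.elim L' L, hL] at hL'
    simpa using hL'
  exact key _ _ h _ _ (hp.map_liftPathQuotient γ e) (hp.map_liftPathQuotient γ' e)

theorem ModuleCat.sum_hom_apply {R : Type*} [Ring R] {M N : ModuleCat.{u} R} {n : ℕ}
    (f : Fin n → (M ⟶ N)) (c : M) : (∑ i, f i) c = ∑ i, f i c := by
  change (ModuleCat.homAddEquiv (∑ i, f i)) c = _
  rw [map_sum, LinearMap.sum_apply]
  rfl

/-- A face of a singular simplex. -/
noncomputable def ContinuousMap.face {E : Type*} [TopologicalSpace E] {n : ℕ} (i : Fin (n + 2))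
    (σ : C(stdSimplex ℝ (Fin (n + 2)), E)) : C(stdSimplex ℝ (Fin (n + 1)), E) :=
  σ.comp ⟨stdSimplex.map i.succAbove, by continuity⟩

namespace IsUniversalCovering

section

variable {E B : Type*} [TopologicalSpace E] [TopologicalSpace B] {p : E → B}
  (hp : IsUniversalCovering p) {b₀ : B} (e₀ : p ⁻¹' {b₀})

/-- A deck transformation with a fixed point is the identity, so the lift of `g⁻¹` at `e₀` is
closed; in a simply connected covering space this forces the loop to be trivial. -/
theorem eq_one_of_deck_apply_eq (g : FundamentalGroup B b₀) (e : E) (h : hp.deck e₀ g e = e) :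
    g = 1 := by
  have := hp.simplyConnectedSpace
  have h₁ : hp.deck e₀ g = hp.deck e₀ 1 :=
    hp.deck_ext (hp.comp_deck e₀ g) (hp.comp_deck e₀ 1) e (by rw [h, map_one]; rfl)
  have h₂ : hp.isCoveringMap.monodromyPerm b₀ g⁻¹ e₀ =
      hp.isCoveringMap.monodromyPerm b₀ 1⁻¹ e₀ := by
    apply Subtype.ext
    rw [← hp.deck_apply, ← hp.deck_apply, h₁]
  rw [← inv_inj]
  exact hp.isCoveringMap.eq_of_monodromy_eq e₀ h₂

end

variable {B E : TopCat.{u}} {p : E → B} (hp : IsUniversalCovering p) {b₀ : B} (e₀ : p ⁻¹' {b₀})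

/-- A group element fixing a simplex fixes its vertex `0`, so the action on simplices is free. -/
instance projective_singularChains_X (n : ℕ) : Projective ((hp.singularChains e₀).X n) := by
  refine Rep.permutationModule.projective (X := (hp.singularSimplices e₀).obj (op (.mk n)))
    fun g σ h ↦ hp.eq_one_of_deck_apply_eq e₀ g (E.toSSetObjEquiv _ σ (stdSimplex.vertex 0)) ?_
  exact congrArg (fun τ ↦ E.toSSetObjEquiv (op (.mk n)) τ (stdSimplex.vertex 0)) h

/-! ### The singular chain complex in low degrees -/

open Rep Simplicial

/-- The chain of a singular simplex. -/
noncomputable def simplexChain {n : ℕ} (σ : C(stdSimplex ℝ (Fin (n + 1)), E)) :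
    (hp.singularChains e₀).X n :=
  permutationModule.basis (X := (hp.singularSimplices e₀).obj (op ⦋n⦌))
    ((E.toSSetObjEquiv (op ⦋n⦌)).symm σ)

theorem closure_range_simplexChain (n : ℕ) :
    AddSubgroup.closure (Set.range (hp.simplexChain e₀ (n := n))) = ⊤ := by
  refine Eq.trans ?_ (permutationModule.closure_range_basis
    (X := (hp.singularSimplices e₀).obj (op ⦋n⦌)))
  congr 1
  exact (E.toSSetObjEquiv (op ⦋n⦌)).symm.surjective.range_comp
    (permutationModule.basis (X := (hp.singularSimplices e₀).obj (op ⦋n⦌)))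

theorem singularChains_d_simplexChain {n : ℕ} (σ : C(stdSimplex ℝ (Fin (n + 2)), E)) :
    (hp.singularChains e₀).d (n + 1) n (hp.simplexChain e₀ σ) =
      ∑ i : Fin (n + 2), (-1 : ℤ) ^ (i : ℕ) • hp.simplexChain e₀ (σ.face i) := by
  have h := AlgebraicTopology.AlternatingFaceMapComplex.obj_d_eq
    (((SimplicialObject.whiskering _ _).obj (linearization ℤ (FundamentalGroup B b₀) ⋙
      toModuleMonoidAlgebra)).obj (hp.singularSimplices e₀)) n
  refine (congrArg (fun f ↦ f (hp.simplexChain e₀ σ)) h).trans ?_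
  refine (ModuleCat.sum_hom_apply _ _).trans ?_
  refine Finset.sum_congr rfl fun i _ ↦ ?_
  exact congrArg (fun c : (hp.singularChains e₀).X n ↦ (-1 : ℤ) ^ (i : ℕ) • c)
    (permutationModule.map_basis ((hp.singularSimplices e₀).δ i) _)

end IsUniversalCovering

/-! ### Singular simplices of dimension at most two -/

theorem stdSimplex.map_succAbove_apply_self {n : ℕ} (i : Fin (n + 2))
    (z : stdSimplex ℝ (Fin (n + 1))) : stdSimplex.map i.succAbove z i = 0 := by
  rw [stdSimplex.map_coe, FunOnFinite.linearMap_apply_apply, Finset.sum_eq_zero]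
  intro j hj
  simp at hj

theorem stdSimplex.map_succAbove_apply {n : ℕ} (i : Fin (n + 2))
    (z : stdSimplex ℝ (Fin (n + 1))) (j : Fin (n + 1)) :
    stdSimplex.map i.succAbove z (i.succAbove j) = z j := by
  rw [stdSimplex.map_coe, FunOnFinite.linearMap_apply_apply, Finset.sum_eq_single j] <;> simp

theorem stdSimplex.continuous_apply {ι : Type*} [Fintype ι] (i : ι) :
    Continuous fun z : stdSimplex ℝ ι ↦ z i :=
  (_root_.continuous_apply i).comp continuous_subtype_val

namespace ContinuousMap

variable {E : Type*} [TopologicalSpace E]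

/-- The singular `1`-simplex given by a map on the line. -/
noncomputable def edge (g : C(ℝ, E)) : C(stdSimplex ℝ (Fin 2), E) :=
  g.comp ⟨fun z ↦ z 1, stdSimplex.continuous_apply 1⟩

/-- The singular `2`-simplex given by a map on the plane. -/
noncomputable def triangle (f : C(ℝ × ℝ, E)) : C(stdSimplex ℝ (Fin 3), E) :=
  f.comp ⟨fun z ↦ (z 1, z 2),
    (stdSimplex.continuous_apply 1).prodMk (stdSimplex.continuous_apply 2)⟩

theorem edge_congr {g g' : C(ℝ, E)} (h : ∀ t, 0 ≤ t → t ≤ 1 → g t = g' t) : g.edge = g'.edge :=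
  ContinuousMap.ext fun z ↦ h (z 1) (z.2.1 1) (stdSimplex.le_one z 1)

/-- A path extends to the line by retracting onto the unit interval. Simplices can then be given by
formulas on `ℝ` and `ℝ × ℝ`, with no membership proofs. -/
theorem edge_surjective : Function.Surjective (edge (E := E)) := fun σ ↦
  ⟨σ.comp (ContinuousMap.comp ⟨stdSimplexHomeomorphUnitInterval.symm, by fun_prop⟩
    ⟨Set.projIcc (0 : ℝ) 1 zero_le_one, continuous_projIcc⟩), by
    refine ContinuousMap.ext fun z ↦ congrArg σ ?_
    rw [← stdSimplexHomeomorphUnitInterval.symm_apply_apply z]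
    refine congrArg stdSimplexHomeomorphUnitInterval.symm ?_
    exact (Set.projIcc_of_mem zero_le_one
      (stdSimplexHomeomorphUnitInterval (stdSimplexHomeomorphUnitInterval.symm
        (stdSimplexHomeomorphUnitInterval z))).2).trans
      (stdSimplexHomeomorphUnitInterval.apply_symm_apply _)⟩

theorem const_surjective :
    Function.Surjective (const (stdSimplex ℝ (Fin 1)) : E → C(stdSimplex ℝ (Fin 1), E)) := fun σ ↦
  ⟨σ default, ContinuousMap.ext fun _ ↦ congrArg σ (Subsingleton.elim _ _)⟩

theorem edge_face_zero (g : C(ℝ, E)) : g.edge.face 0 = const _ (g 1) := by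
  refine ContinuousMap.ext fun z ↦ congrArg g ?_
  refine (stdSimplex.map_succAbove_apply 0 z 0).trans ?_
  simp

theorem edge_face_one (g : C(ℝ, E)) : g.edge.face 1 = const _ (g 0) :=
  ContinuousMap.ext fun z ↦ congrArg g (stdSimplex.map_succAbove_apply_self 1 z)

theorem triangle_face_zero (f : C(ℝ × ℝ, E)) :
    f.triangle.face 0 = (f.comp ⟨fun t ↦ (1 - t, t), by fun_prop⟩).edge := by
  refine ContinuousMap.ext fun z ↦ congrArg f (Prod.ext ?_ ?_)
  · exact (stdSimplex.map_succAbove_apply 0 z 0).trans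
      (eq_sub_of_add_eq (stdSimplex.add_eq_one z))
  · exact stdSimplex.map_succAbove_apply 0 z 1

theorem triangle_face_one (f : C(ℝ × ℝ, E)) :
    f.triangle.face 1 = (f.comp ⟨fun t ↦ (0, t), by fun_prop⟩).edge :=
  ContinuousMap.ext fun z ↦ congrArg f (Prod.ext (stdSimplex.map_succAbove_apply_self 1 z)
    (stdSimplex.map_succAbove_apply 1 z 1))

theorem triangle_face_two (f : C(ℝ × ℝ, E)) :
    f.triangle.face 2 = (f.comp ⟨fun t ↦ (t, 0), by fun_prop⟩).edge :=
  ContinuousMap.ext fun z ↦ congrArg f (Prod.ext (stdSimplex.map_succAbove_apply 2 z 1)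
    (stdSimplex.map_succAbove_apply_self 2 z))

end ContinuousMap

/-! ### Vanishing of the first homology -/

namespace IsUniversalCovering

variable {B E : TopCat.{u}} {p : E → B} (hp : IsUniversalCovering p) {b₀ : B} (e₀ : p ⁻¹' {b₀})

/-- The boundaries of dimension one. -/
noncomputable def boundaries : AddSubgroup ((hp.singularChains e₀).X 1) :=
  (((hp.singularChains e₀).d 2 1).hom.toAddMonoidHom).range

theorem d_edge (g : C(ℝ, E)) :
    (hp.singularChains e₀).d 1 0 (hp.simplexChain e₀ g.edge) =
      hp.simplexChain e₀ (.const _ (g 1)) - hp.simplexChain e₀ (.const _ (g 0)) := by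
  refine (hp.singularChains_d_simplexChain e₀ g.edge).trans ?_
  rw [Fin.sum_univ_two, g.edge_face_zero, g.edge_face_one]
  simp [sub_eq_add_neg]

theorem triangle_mem_boundaries (f : C(ℝ × ℝ, E)) {g₀ g₁ g₂ : C(ℝ, E)}
    (h₀ : ∀ t, 0 ≤ t → t ≤ 1 → f (1 - t, t) = g₀ t) (h₁ : ∀ t, 0 ≤ t → t ≤ 1 → f (0, t) = g₁ t)
    (h₂ : ∀ t, 0 ≤ t → t ≤ 1 → f (t, 0) = g₂ t) :
    hp.simplexChain e₀ g₀.edge - hp.simplexChain e₀ g₁.edge + hp.simplexChain e₀ g₂.edge ∈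
      hp.boundaries e₀ := by
  refine ⟨hp.simplexChain e₀ f.triangle, (hp.singularChains_d_simplexChain e₀ _).trans ?_⟩
  have h₀' : f.triangle.face 0 = g₀.edge :=
    f.triangle_face_zero.trans (ContinuousMap.edge_congr h₀)
  have h₁' : f.triangle.face 1 = g₁.edge := f.triangle_face_one.trans (ContinuousMap.edge_congr h₁)
  have h₂' : f.triangle.face 2 = g₂.edge := f.triangle_face_two.trans (ContinuousMap.edge_congr h₂)
  rw [Fin.sum_univ_three, h₀', h₁', h₂']
  simp [sub_eq_add_neg]

theorem const_mem_boundaries (a : E) :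
    hp.simplexChain e₀ (ContinuousMap.const ℝ a).edge ∈ hp.boundaries e₀ := by
  have := hp.triangle_mem_boundaries e₀ (.const _ a) (g₀ := .const ℝ a) (g₁ := .const ℝ a)
    (g₂ := .const ℝ a) (fun _ _ _ ↦ rfl) (fun _ _ _ ↦ rfl) (fun _ _ _ ↦ rfl)
  rwa [sub_self, zero_add] at this

/-- The triangle is collapsed onto the concatenated path by `(x, y) ↦ x / 2 + y`: one leg runs
through the first half, the hypotenuse through the second, and the other leg through the whole path.
-/
theorem trans_mem_boundaries {a b c : E} (γ : Path a b) (γ' : Path b c) :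
    hp.simplexChain e₀ γ'.extend.edge - hp.simplexChain e₀ (γ.trans γ').extend.edge +
      hp.simplexChain e₀ γ.extend.edge ∈ hp.boundaries e₀ := by
  refine hp.triangle_mem_boundaries e₀
    ((γ.trans γ').extend.comp ⟨fun x ↦ x.1 / 2 + x.2, by fun_prop⟩) (fun t h0 h1 ↦ ?_)
    (fun t h0 h1 ↦ ?_) (fun t h0 h1 ↦ ?_)
  · refine (Path.extend_trans_of_half_le γ γ' (t := (1 - t) / 2 + t) (by linarith)).trans ?_
    congr 1
    ring
  · refine congrArg (γ.trans γ').extend ?_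
    simp
  · refine (Path.extend_trans_of_le_half γ γ' (t := t / 2 + 0) (by linarith)).trans ?_
    congr 1
    ring

theorem homotopy_mem_boundaries {a b : E} {γ γ' : Path a b} (H : γ.Homotopy γ') :
    hp.simplexChain e₀ γ.extend.edge - hp.simplexChain e₀ γ'.extend.edge ∈ hp.boundaries e₀ := by
  let r : C(ℝ, unitInterval) := ⟨Set.projIcc (0 : ℝ) 1 zero_le_one, continuous_projIcc⟩
  have r0 : r 0 = 0 := Set.projIcc_left (zero_le_one' ℝ)
  have r1 : r 1 = 1 := Set.projIcc_right (zero_le_one' ℝ)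
  let K : C(ℝ × ℝ, E) := H.toContinuousMap.comp (r.prodMap r)
  have K0 (t : ℝ) : K (0, t) = γ.extend t := by
    change H (r 0, r t) = _
    rw [r0, H.apply_zero]
    rfl
  have K1 (t : ℝ) : K (1, t) = γ'.extend t := by
    change H (r 1, r t) = _
    rw [r1, H.apply_one]
    rfl
  have Ka (t : ℝ) : K (t, 0) = a := by
    change H (r t, r 0) = _
    rw [r0, H.source]
  have Kb (t : ℝ) : K (t, 1) = b := by
    change H (r t, r 1) = _
    rw [r1, H.target]
  -- The square of the homotopy is cut along its diagonal. In the difference of the two triangles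
  -- the diagonal cancels, and the constant sides `a` and `b` are boundaries themselves.
  have h₁ := hp.triangle_mem_boundaries e₀ (K.comp ⟨fun x ↦ (x.2, x.1 + x.2), by fun_prop⟩)
    (g₀ := .const _ b) (g₁ := K.comp ⟨fun t ↦ (t, t), by fun_prop⟩) (g₂ := γ.extend)
    (fun t _ _ ↦ by simpa using Kb t) (fun t _ _ ↦ by simp) (fun t _ _ ↦ by simpa using K0 t)
  have h₂ := hp.triangle_mem_boundaries e₀ (K.comp ⟨fun x ↦ (x.1 + x.2, x.2), by fun_prop⟩)
    (g₀ := γ'.extend) (g₁ := K.comp ⟨fun t ↦ (t, t), by fun_prop⟩) (g₂ := .const _ a)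
    (fun t _ _ ↦ by simpa using K1 t) (fun t _ _ ↦ by simp) (fun t _ _ ↦ by simpa using Ka t)
  convert add_mem (sub_mem h₁ h₂) (sub_mem (hp.const_mem_boundaries e₀ a)
    (hp.const_mem_boundaries e₀ b)) using 1
  abel

/-- By simple connectedness the chosen path to `g 0` followed by `g` is homotopic to the chosen path
to `g 1`. -/
theorem edge_mem_boundaries [SimplyConnectedSpace E] (x₀ : E) (g : C(ℝ, E)) :
    hp.simplexChain e₀ g.edge -
      (hp.simplexChain e₀ (PathConnectedSpace.somePath x₀ (g 1)).extend.edge -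
        hp.simplexChain e₀ (PathConnectedSpace.somePath x₀ (g 0)).extend.edge) ∈
      hp.boundaries e₀ := by
  let γ : Path (g 0) (g 1) := ⟨g.comp ⟨_, continuous_subtype_val⟩, by simp, by simp⟩
  have hγ : γ.extend.edge = g.edge :=
    ContinuousMap.edge_congr fun t h h' ↦ Path.extend_apply γ ⟨h, h'⟩
  have h₁ := hp.trans_mem_boundaries e₀ (PathConnectedSpace.somePath x₀ (g 0)) γ
  obtain ⟨H⟩ := SimplyConnectedSpace.paths_homotopic
    ((PathConnectedSpace.somePath x₀ (g 0)).trans γ) (PathConnectedSpace.somePath x₀ (g 1))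
  convert add_mem h₁ (hp.homotopy_mem_boundaries e₀ H) using 1
  rw [hγ]
  abel

open Rep Simplicial

/-- Sending a point to its chosen path from `e₀` is a contracting homotopy modulo boundaries: `c - P
(∂c)` is always a boundary. The choice of paths need not be equivariant, so `P` is only additive,
which suffices for exactness. -/
theorem mem_boundaries_of_d_eq_zero [SimplyConnectedSpace E] (c : (hp.singularChains e₀).X 1)
    (hc : (hp.singularChains e₀).d 1 0 c = 0) : c ∈ hp.boundaries e₀ := by
  let P : (hp.singularChains e₀).X 0 →+ (hp.singularChains e₀).X 1 :=
    permutationModule.descAddMonoidHom (X := (hp.singularSimplices e₀).obj (op ⦋0⦌)) fun s ↦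
      hp.simplexChain e₀ (PathConnectedSpace.somePath e₀.1
        (E.toSSetObjEquiv (op ⦋0⦌) s (stdSimplex.vertex 0))).extend.edge
  have hP (x : E) : P (hp.simplexChain e₀ (.const _ x)) =
      hp.simplexChain e₀ (PathConnectedSpace.somePath e₀.1 x).extend.edge :=
    permutationModule.descAddMonoidHom_basis _ _
  have key (c : (hp.singularChains e₀).X 1) :
      c - P ((hp.singularChains e₀).d 1 0 c) ∈ hp.boundaries e₀ := by
    have hc : c ∈ AddSubgroup.closure (Set.range (hp.simplexChain e₀ (n := 1))) := by
      rw [hp.closure_range_simplexChain]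
      trivial
    induction hc using AddSubgroup.closure_induction with
    | mem c hc =>
      obtain ⟨σ, rfl⟩ := hc
      obtain ⟨g, rfl⟩ := ContinuousMap.edge_surjective σ
      rw [d_edge, map_sub, hP, hP]
      exact hp.edge_mem_boundaries e₀ _ g
    | zero => simp
    | add c c' _ _ h h' =>
      convert add_mem h h' using 1
      rw [map_add, map_add]
      abel
    | neg c _ h =>
      convert neg_mem h using 1
      rw [map_neg, map_neg]
      abel
  have := key c
  rwa [hc, map_zero, sub_zero] at this

theorem isZero_homology_one : Limits.IsZero (hp.homology e₀ 1) := by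
  have := hp.simplyConnectedSpace
  refine HomologicalComplex.ExactAt.isZero_homology ?_
  rw [HomologicalComplex.exactAt_iff' _ 2 1 0 (by simp) (by simp),
    ShortComplex.moduleCat_exact_iff]
  exact hp.mem_boundaries_of_d_eq_zero e₀

end IsUniversalCovering

/-! ### The augmentation and homology in degree zero -/

namespace IsUniversalCovering

open Rep Simplicial

variable {B E : TopCat.{u}} {p : E → B} (hp : IsUniversalCovering p) {b₀ : B} (e₀ : p ⁻¹' {b₀})

/-- The augmentation of the singular chain complex. -/
noncomputable def augmentation : (hp.singularChains e₀).X 0 ⟶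
    toModuleMonoidAlgebra.obj (Rep.trivial ℤ (FundamentalGroup B b₀) (ULift.{u} ℤ)) :=
  permutationModule.desc (X := (hp.singularSimplices e₀).obj (op ⦋0⦌))
    (N := toModuleMonoidAlgebra.obj (Rep.trivial ℤ (FundamentalGroup B b₀) (ULift.{u} ℤ)))
    (fun _ ↦ (ULift.up 1 : ULift ℤ)) fun g _ ↦
      ((Representation.single_smul (Representation.trivial ℤ (FundamentalGroup B b₀) (ULift ℤ))
        (1 : ℤ) g (ULift.up 1 : ULift ℤ)).trans (one_smul ℤ _)).symm

theorem augmentation_simplexChain (σ : C(stdSimplex ℝ (Fin 1), E)) :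
    hp.augmentation e₀ (hp.simplexChain e₀ σ) = (ULift.up 1 : ULift ℤ) :=
  permutationModule.desc_basis _ _ _

theorem d_comp_augmentation : (hp.singularChains e₀).d 1 0 ≫ hp.augmentation e₀ = 0 := by
  refine permutationModule.hom_ext (X := (hp.singularSimplices e₀).obj (op ⦋1⦌)) fun x ↦ ?_
  obtain ⟨σ, rfl⟩ := (E.toSSetObjEquiv (op ⦋1⦌)).symm.surjective x
  obtain ⟨g, rfl⟩ := ContinuousMap.edge_surjective σ
  refine (congrArg (hp.augmentation e₀) (hp.d_edge e₀ g)).trans ?_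
  rw [map_sub, augmentation_simplexChain, augmentation_simplexChain]
  exact sub_self (ULift.up 1 : ULift ℤ)

instance epi_augmentation : Epi (hp.augmentation e₀) := by
  rw [ModuleCat.epi_iff_surjective]
  rintro ⟨n⟩
  refine ⟨n • hp.simplexChain e₀ (.const _ e₀), ?_⟩
  rw [map_zsmul, augmentation_simplexChain]
  change n • (ULift.up 1 : ULift ℤ) = _
  ext
  simp

/-- Path connectedness makes each point homologous to `e₀`, so a `0`-chain is homologous to its
degree times `e₀`, and a chain of degree zero is a boundary. -/
theorem exact_augmentation :
    (ShortComplex.mk _ _ (hp.d_comp_augmentation e₀)).Exact := by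
  have := hp.simplyConnectedSpace
  let deg : (hp.singularChains e₀).X 0 →+ ℤ :=
    permutationModule.descAddMonoidHom (X := (hp.singularSimplices e₀).obj (op ⦋0⦌)) fun _ ↦ 1
  have hdeg (σ) : deg (hp.simplexChain e₀ σ) = 1 := permutationModule.descAddMonoidHom_basis _ _
  have key (c : (hp.singularChains e₀).X 0) :
      hp.augmentation e₀ c = (ULift.up (deg c) : ULift ℤ) ∧
        ∃ c' : (hp.singularChains e₀).X 1, (hp.singularChains e₀).d 1 0 c' =
          c - deg c • hp.simplexChain e₀ (.const _ e₀) := by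
    have hc : c ∈ AddSubgroup.closure (Set.range (hp.simplexChain e₀ (n := 0))) := by
      rw [hp.closure_range_simplexChain]
      trivial
    induction hc using AddSubgroup.closure_induction with
    | mem c hc =>
      obtain ⟨σ, rfl⟩ := hc
      obtain ⟨x, rfl⟩ := ContinuousMap.const_surjective σ
      rw [hdeg, augmentation_simplexChain]
      refine ⟨rfl, hp.simplexChain e₀ (PathConnectedSpace.somePath e₀.1 x).extend.edge, ?_⟩
      rw [d_edge, one_smul, Path.extend_one, Path.extend_zero]
    | zero =>
      rw [map_zero, map_zero]
      exact ⟨rfl, 0, by simp⟩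
    | add c c' _ _ h h' =>
      obtain ⟨h, x, hx⟩ := h
      obtain ⟨h', x', hx'⟩ := h'
      rw [map_add, map_add, h, h']
      refine ⟨rfl, x + x', ?_⟩
      rw [map_add, hx, hx', add_smul]
      abel
    | neg c _ h =>
      obtain ⟨h, x, hx⟩ := h
      rw [map_neg, map_neg, h]
      refine ⟨rfl, -x, ?_⟩
      rw [map_neg, hx, neg_smul]
      abel
  rw [ShortComplex.moduleCat_exact_iff]
  intro c hc
  obtain ⟨h, x, hx⟩ := key c
  have h₀ : deg c = 0 := congrArg ULift.down (h.symm.trans hc)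
  rw [h₀, zero_smul, sub_zero] at hx
  exact ⟨x, hx⟩

/-- The homology in degree zero of the universal covering. -/
noncomputable def homologyZeroIso : hp.homology e₀ 0 ≅
    toModuleMonoidAlgebra.obj (Rep.trivial ℤ (FundamentalGroup B b₀) (ULift.{u} ℤ)) :=
  (hp.singularChains e₀).isoHomologyι₀ ≪≫
    ((hp.singularChains e₀).opcyclesIsCokernel 1 0 (by simp)).coconePointUniqueUpToIso
      (hp.exact_augmentation e₀).gIsCokernel

end IsUniversalCovering

/-! ### The spectral sequence -/

/-- The spectral sequence of extensions of the homology of a complex of projectives. -/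
theorem exists_spectralSequence_homComplex {C : Type*} [Category.{u} C] [Abelian C]
    [EnoughInjectives C] [HasExt.{u} C] (K : ChainComplex C ℕ) [∀ n, Projective (K.X n)] (M : C) :
    ∃ S : E₂CohomologicalSpectralSequenceNat AddCommGrpCat.{u},
      (∀ i j : ℕ, Nonempty ((S.page 2 le_rfl).X (i, j) ≃+ Abelian.Ext.{u} (K.homology j) M i)) ∧
      ConvergesTo S fun n ↦ (homComplex K M).homology n := by
  let _ := HasDerivedCategory.standard C
  have : (DerivedCategory.Q.obj (K.extend ComplexShape.embeddingDownNat)).IsLE 0 := inferInstance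
  obtain ⟨S, hS, hS'⟩ := DerivedCategory.exists_spectralSequence_ext
    (DerivedCategory.Q.obj (K.extend ComplexShape.embeddingDownNat)) M _
    fun n ↦ homologyHomComplexAddEquivHom K M n
  refine ⟨S, fun i j ↦ ?_, hS'⟩
  let e : (DerivedCategory.homologyFunctor C (-j)).obj
      (DerivedCategory.Q.obj (K.extend ComplexShape.embeddingDownNat)) ≅ K.homology j :=
    (DerivedCategory.homologyFunctorFactors C (-j)).app _ ≪≫
      K.extendHomologyIso ComplexShape.embeddingDownNat rfl
  obtain ⟨f⟩ := hS i j
  exact ⟨f.trans ((((Abelian.extFunctor i).mapIso e.symm.op).app M).addCommGroupIsoToAddEquiv)⟩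

/-- If `E₂^{0,1}` vanishes, then `H¹` is `E₂^{1,0}`. -/
theorem ConvergesTo.nonempty_addEquiv_one
    {S : E₂CohomologicalSpectralSequenceNat AddCommGrpCat.{u}}
    {H : ℕ → AddCommGrpCat.{u}} (h : ConvergesTo S H)
    (h₀ : Limits.IsZero ((S.page 2 le_rfl).X (0, 1))) :
    Nonempty (H 1 ≃+ (S.page 2 le_rfl).X (1, 0)) := by
  obtain ⟨Fil, -, hFil, hFil', hgr⟩ := h 1
  -- At the spot `(0, 1)` the limit is only guaranteed from page `3` on, so the vanishing is first
  -- passed to that page; at `(1, 0)` page `2` is already final.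
  have h₁ : Limits.IsZero ((S.page 3 (by simp)).X (0, 1)) :=
    Limits.IsZero.of_iso (ShortComplex.isZero_homology_of_isZero_X₂ _ h₀)
      (S.iso 2 3 (0, 1)).symm
  obtain ⟨f⟩ := hgr 0 1 rfl 3 (by simp) (by simp) (by simp)
  obtain ⟨g⟩ := hgr 1 0 rfl 2 le_rfl (by simp) (by simp)
  have h₂ : Fil 1 = ⊤ := by
    have := AddCommGrpCat.isZero_iff_subsingleton.1 h₁
    have := f.toEquiv.subsingleton
    have := QuotientAddGroup.addSubgroup_eq_top_of_subsingleton _ this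
    rw [AddSubgroup.addSubgroupOf_eq_top, hFil] at this
    exact top_le_iff.1 this
  refine ⟨AddEquiv.trans (AddEquiv.symm ?_) g⟩
  refine (QuotientAddGroup.quotientAddEquivOfEq ?_).trans
    ((QuotientAddGroup.quotientBot).trans ((AddEquiv.addSubgroupCongr h₂).trans
      AddSubgroup.topEquiv))
  rw [hFil']
  simp

theorem mainTheorem9 {B E : TopCat.{u}} [ConnectedSpace B] (F : LocalSystem B)
    {p : E → B} (hp : IsUniversalCovering p) (b₀ : B) (e₀ : p ⁻¹' {b₀}) :
    (∃ S : E₂CohomologicalSpectralSequenceNat AddCommGrpCat.{u},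
      (∀ i j : ℕ, Nonempty ((S.page 2 le_rfl).X (i, j) ≅ extGroup (hp.homology e₀ j) (F.fibre b₀) i)) ∧
      ConvergesTo S (F.cohomology hp e₀)) ∧
    Nonempty (F.cohomology hp e₀ 1 ≅ groupCohomologyExt (F.fibre b₀) 1) := by
  obtain ⟨S, hS, hS'⟩ :=
    exists_spectralSequence_homComplex (hp.singularChains e₀) (F.fibre b₀)
  refine ⟨⟨S, fun i j ↦ (hS i j).map fun f ↦ AddEquiv.toAddCommGrpIso f, hS'⟩, ?_⟩
  -- This entry is `Ext⁰(H₁, M) = Hom(H₁, M)`, with `H₁ = 0`.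
  have h₀ : Limits.IsZero ((S.page 2 le_rfl).X (0, 1)) := by
    rw [AddCommGrpCat.isZero_iff_subsingleton]
    obtain ⟨f⟩ := hS 0 1
    refine @Equiv.subsingleton _ _ (f.toEquiv.trans Abelian.Ext.homEquiv₀) ⟨fun a b ↦ ?_⟩
    exact (hp.isZero_homology_one e₀).eq_of_src a b
  obtain ⟨f⟩ := ConvergesTo.nonempty_addEquiv_one hS' h₀
  obtain ⟨g⟩ := hS 1 0
  exact ⟨AddEquiv.toAddCommGrpIso ((f.trans g).trans (((Abelian.extFunctor 1).mapIso
    (hp.homologyZeroIso e₀).symm.op).app (F.fibre b₀)).addCommGroupIsoToAddEquiv)⟩
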